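/- Let $\Omega\subset\mathbb R^N$ be an open set (in particular, any domain), and let $A=\partial_h(\mathscr A^{hk}(x)\,\partial_k)$ (summation over repeated indices $h,k=1,\dots,N$), where the $\mathscr A^{hk}(x)=\{a^{hk}_{ij}(x)\}$ are $m\times m$ matrices whose entries are complex valued functions in $L^\infty(\Omega)$. Let $\mathring H^1(\Omega)$ be the closure of the complex valued functions in $C^\infty_c(\Omega)$ in the $H^1(\Omega)$ norm, let $\langle\cdot,\cdot\rangle$ be the Hermitian product on $\mathbb C^m$, and let $M^*$ be the conjugate transpose of a matrix $M$. Let $\varphi:(0,\infty)\to(0,\infty)$ satisfy: (i) $\varphi\in C^1((0,\infty))$; (ii) $(s\varphi(s))'>0$ for all $s>0$; (iii) the range of $s\mapsto s\varphi(s)$ is $(0,\infty)$; (iv) there are $s_0>0$, $C_1,C_2>0$ and a real $r>-1$ with $C_1s^r\le (s\varphi(s))'\le C_2s^r$ for $0<s<s_0$; if $r=0$, moreover, $\lim_{s\to0^+}\varphi(s)$ exists, is finite and positive, and $\lim_{s\to0^+}s\varphi'(s)=0$; (v) there is $s_1>s_0$ such that either $\varphi'(s)\ge0$ for all $s\ge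 s_1$, or $\varphi'(s)\le0$ for all $s\ge s_1$. Let $\zeta$ be the inverse function of the strictly increasing function $s\mapsto s\sqrt{\varphi(s)}$ of $(0,\infty)$ onto itself, and put $\Theta(t)=\zeta(t)/t$, $\Lambda(t)=t\,\Theta'(t)/\Theta(t)$ for $t>0$. The operator $A$ is called $L^\Phi$-dissipative if $$\operatorname{Re}\int_\Omega\langle\mathscr A^{hk}\partial_ku,\partial_h(\varphi(|u|)u)\rangle\,dx\ge0$$ for every $u\in[\mathring H^1(\Omega)]^m$ such that $\varphi(|u|)u\in[\mathring H^1(\Omega)]^m$. It is called strict $L^\Phi$-dissipative if there is $\kappa>0$ such that $$\operatorname{Re}\int_\Omega\langle\mathscr A^{hk}\partial_ku,\partial_h(\varphi(|u|)u)\rangle\,dx\ge\kappa\int_\Omega|\nabla(\sqrt{\varphi(|u|)}\,u)|^2dx$$ for all such $u$ (here $\varphi(|u|)u$ and $\sqrt{\varphi(|u|)}\,u$ are taken to be $0$ where $u=0$). For $v\in[\mathring H^1(\Omega)]^m$ put $$J(v)=\operatorname{Re}\int_\Omega\Big(\langle\mathscr A^{hk}\partial_kv,\partial_hv\rangle+\Lambda(|v|)|v|^{-2}\langle(\mathscr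 A^{hk}-(\mathscr A^{kh})^*)v,\partial_hv\rangle\operatorname{Re}\langle v,\partial_kv\rangle-\Lambda^2(|v|)|v|^{-4}\langle\mathscr A^{hk}v,v\rangle\operatorname{Re}\langle v,\partial_kv\rangle\operatorname{Re}\langle v,\partial_hv\rangle\Big)dx,$$ the integrand being extended by zero to the set where $v$ vanishes. Then: (a) $A$ is $L^\Phi$-dissipative if and only if $J(v)\ge0$ for all $v\in[\mathring H^1(\Omega)]^m$. (b) $A$ is strict $L^\Phi$-dissipative if and only if there is $\kappa>0$ such that $J(v)\ge\kappa\int_\Omega|\nabla v|^2dx$ for all $v\in[\mathring H^1(\Omega)]^m$. -/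

import Mathlib

open MeasureTheory Set Filter Topology
open scoped ContDiff Matrix

namespace FunctionalDissipativity

noncomputable section

/-! ### The function `φ` and the functions derived from it

Only the values of `φ : ℝ → ℝ` on `(0, ∞)` matter. -/

/-- The standing assumptions on the positive function `φ : (0, ∞) → (0, ∞)`:
`φ` is `C¹`; `(s φ(s))' > 0`; `s φ(s)` has range `(0, ∞)`; `(s φ(s))'` is comparable to `s ^ r`
near the origin for some `r > -1` (with extra requirements if `r = 0`); and `φ'` has a
constant weak sign on a neighbourhood of infinity. -/
structure Admissible (φ : ℝ → ℝ) : Prop where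
  pos : ∀ s, 0 < s → 0 < φ s
  contDiffOn : ContDiffOn ℝ 1 φ (Ioi 0)
  deriv_pos : ∀ s, 0 < s → 0 < deriv (fun σ => σ * φ σ) s
  range_eq : (fun s => s * φ s) '' Ioi 0 = Ioi 0
  asymptotics : ∃ s₀ : ℝ, 0 < s₀ ∧
    (∃ C₁ C₂ r : ℝ, 0 < C₁ ∧ 0 < C₂ ∧ -1 < r ∧
      (∀ s ∈ Ioo 0 s₀, C₁ * s ^ r ≤ deriv (fun σ => σ * φ σ) s ∧
        deriv (fun σ => σ * φ σ) s ≤ C₂ * s ^ r) ∧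
      (r = 0 → (∃ l : ℝ, 0 < l ∧ Tendsto φ (𝓝[>] 0) (𝓝 l)) ∧
        Tendsto (fun s => s * deriv φ s) (𝓝[>] 0) (𝓝 0))) ∧
    (∃ s₁ : ℝ, s₀ < s₁ ∧ ((∀ s, s₁ ≤ s → 0 ≤ deriv φ s) ∨ (∀ s, s₁ ≤ s → deriv φ s ≤ 0)))

/-- `ζ` is the inverse, on `(0, ∞)`, of the strictly increasing function `s ↦ s √φ(s)`. -/
def zeta (φ : ℝ → ℝ) (t : ℝ) : ℝ :=
  Function.invFunOn (fun s => s * √(φ s)) (Ioi 0) t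

/-- `Θ(t) = ζ(t) / t`. -/
def Theta (φ : ℝ → ℝ) (t : ℝ) : ℝ := zeta φ t / t

/-- `Λ(t) = t Θ'(t) / Θ(t)`. -/
def Lam (φ : ℝ → ℝ) (t : ℝ) : ℝ := t * deriv (Theta φ) t / Theta φ t

/-! ### Weak derivatives and `H¹₀` for functions with values in `ℂ^m` -/

/-- Points of `ℝ^N`. -/
abbrev Pt (N : ℕ) := EuclideanSpace ℝ (Fin N)

/-- Vectors of `ℂ^m`, with the Hermitian norm. -/
abbrev CVec (m : ℕ) := EuclideanSpace ℂ (Fin m)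

variable {N m : ℕ}

/-- The classical partial derivative `∂_k f`. -/
def classicalPartial {F : Type*} [NormedAddCommGroup F] [NormedSpace ℝ F]
    (k : Fin N) (f : Pt N → F) (x : Pt N) : F :=
  fderiv ℝ f x (EuclideanSpace.single k (1 : ℝ))

/-- `f` is a `C^∞` function with compact support contained in `Ω`. -/
def IsTestFunction {F : Type*} [NormedAddCommGroup F] [NormedSpace ℝ F]
    (Ω : Set (Pt N)) (f : Pt N → F) : Prop :=
  ContDiff ℝ ∞ f ∧ HasCompactSupport f ∧ tsupport f ⊆ Ω

/-- `g` is a weak (distributional) partial derivative `∂_k u` on `Ω`. -/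
def IsWeakPartial (Ω : Set (Pt N)) (k : Fin N) (u g : Pt N → CVec m) : Prop :=
  LocallyIntegrableOn u Ω ∧ LocallyIntegrableOn g Ω ∧
    ∀ η : Pt N → ℝ, IsTestFunction Ω η →
      ∫ x in Ω, classicalPartial k η x • u x = - ∫ x in Ω, η x • g x

open Classical in
/-- The weak partial derivative `∂_k u` on `Ω`, determined up to a null subset of the open set
`Ω` (and `0` by convention if `u` has none). -/
def weakPartial (Ω : Set (Pt N)) (k : Fin N) (u : Pt N → CVec m) : Pt N → CVec m :=
  if h : ∃ g, IsWeakPartial Ω k u g then h.choose else 0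

/-- `u ∈ [H¹(Ω)]^m`: `u` and its weak partial derivatives are in `L²(Ω)`. -/
def MemH1 (Ω : Set (Pt N)) (u : Pt N → CVec m) : Prop :=
  MemLp u 2 (volume.restrict Ω) ∧
    ∀ k : Fin N, ∃ g, IsWeakPartial Ω k u g ∧ MemLp g 2 (volume.restrict Ω)

/-- `u ∈ [H¹₀(Ω)]^m`: `u` is in the closure of the test functions in the `H¹(Ω)` norm. -/
def MemH10 (Ω : Set (Pt N)) (u : Pt N → CVec m) : Prop :=
  MemH1 Ω u ∧ ∃ f : ℕ → Pt N → CVec m, (∀ n, IsTestFunction Ω (f n)) ∧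
    Tendsto (fun n => eLpNorm (fun x => f n x - u x) 2 (volume.restrict Ω)) atTop (𝓝 0) ∧
    ∀ k : Fin N, Tendsto (fun n => eLpNorm
      (fun x => classicalPartial k (f n) x - weakPartial Ω k u x) 2 (volume.restrict Ω))
      atTop (𝓝 0)

/-- The squared norm `|∇u|² = ∑ₖ |∂ₖu|²`. -/
def gradSq (Ω : Set (Pt N)) (u : Pt N → CVec m) (x : Pt N) : ℝ :=
  ∑ k : Fin N, ‖weakPartial Ω k u x‖ ^ 2

/-! ### The operator `A = ∂_h (𝒜^{hk}(x) ∂_k)` -/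

/-- The Hermitian product `⟨a, b⟩ = ∑ᵢ aᵢ b̄ᵢ` on `ℂ^m`, linear in the first argument. -/
def herm (a b : CVec m) : ℂ := inner ℂ b a

/-- The action of an `m × m` matrix on `ℂ^m`. -/
def act (M : Matrix (Fin m) (Fin m) ℂ) (a : CVec m) : CVec m := WithLp.toLp 2 (M *ᵥ a.ofLp)

/-- The coefficients `𝒜^{hk}(x) = {a^{hk}_{ij}(x)}` of an operator: `𝒜 h k x i j`. -/
abbrev Coeff (N m : ℕ) := Fin N → Fin N → Pt N → Matrix (Fin m) (Fin m) ℂ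

/-- All entries of the coefficient matrices are in `L^∞(Ω)`. -/
def BoundedCoeff (Ω : Set (Pt N)) (A : Coeff N m) : Prop :=
  ∀ h k i j, MemLp (fun x => A h k x i j) ⊤ (volume.restrict Ω)

/-- `Re ∫_Ω ⟨𝒜^{hk} ∂_k u, ∂_h w⟩ dx`. -/
def sesqForm (Ω : Set (Pt N)) (A : Coeff N m) (u w : Pt N → CVec m) : ℝ :=
  (∫ x in Ω, ∑ h, ∑ k, herm (act (A h k x) (weakPartial Ω k u x)) (weakPartial Ω h w x)).re

/-- The function `φ(|u|) u`. -/
def phiMul (φ : ℝ → ℝ) (u : Pt N → CVec m) (x : Pt N) : CVec m := φ ‖u x‖ • u x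

/-- The function `√(φ(|u|)) u`. -/
def sqrtPhiMul (φ : ℝ → ℝ) (u : Pt N → CVec m) (x : Pt N) : CVec m := √(φ ‖u x‖) • u x

/-- `A` is `L^Φ`-dissipative (functional dissipative). -/
def IsDissipative (Ω : Set (Pt N)) (φ : ℝ → ℝ) (A : Coeff N m) : Prop :=
  ∀ u : Pt N → CVec m, MemH10 Ω u → MemH10 Ω (phiMul φ u) →
    0 ≤ sesqForm Ω A u (phiMul φ u)

/-- `A` is strict `L^Φ`-dissipative. -/
def IsStrictDissipative (Ω : Set (Pt N)) (φ : ℝ → ℝ) (A : Coeff N m) : Prop :=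
  ∃ κ : ℝ, 0 < κ ∧ ∀ u : Pt N → CVec m, MemH10 Ω u → MemH10 Ω (phiMul φ u) →
    κ * ∫ x in Ω, gradSq Ω (sqrtPhiMul φ u) x ≤ sesqForm Ω A u (phiMul φ u)

/-- The integrand of the functional, on the set where `v` does not vanish:
`⟨𝒜^{hk} ∂_k v, ∂_h v⟩ + Λ(|v|) |v|⁻² ⟨(𝒜^{hk} - (𝒜^{kh})^*) v, ∂_h v⟩ Re⟨v, ∂_k v⟩
  - Λ²(|v|) |v|⁻⁴ ⟨𝒜^{hk} v, v⟩ Re⟨v, ∂_k v⟩ Re⟨v, ∂_h v⟩`, summed over `h` and `k`. -/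
def functionalIntegrand (Ω : Set (Pt N)) (φ : ℝ → ℝ) (A : Coeff N m) (v : Pt N → CVec m)
    (x : Pt N) : ℂ :=
  ∑ h, ∑ k,
    (herm (act (A h k x) (weakPartial Ω k v x)) (weakPartial Ω h v x)
      + (Lam φ ‖v x‖ : ℂ) * ((‖v x‖ ^ 2)⁻¹ : ℝ)
        * herm (act (A h k x - (A k h x)ᴴ) (v x)) (weakPartial Ω h v x)
        * ((herm (v x) (weakPartial Ω k v x)).re : ℂ)
      - (Lam φ ‖v x‖ : ℂ) ^ 2 * ((‖v x‖ ^ 4)⁻¹ : ℝ)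
        * herm (act (A h k x) (v x)) (v x)
        * ((herm (v x) (weakPartial Ω k v x)).re : ℂ)
        * ((herm (v x) (weakPartial Ω h v x)).re : ℂ))

/-- The real part of the integral over `Ω` of the integrand above, extended by zero to the set
where `v` vanishes. -/
def functional (Ω : Set (Pt N)) (φ : ℝ → ℝ) (A : Coeff N m) (v : Pt N → CVec m) : ℝ :=
  (∫ x in Ω, {y | v y ≠ 0}.indicator (functionalIntegrand Ω φ A v) x).re

end

end FunctionalDissipativity

namespace FunctionalDissipativity

variable {N m : ℕ} {Ω : Set (Pt N)} {φ : ℝ → ℝ}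

/-! Put `v = √φ(|u|) u`. Then `|v| = |u| √φ(|u|)`, hence `u = Θ(|v|) v` and `φ(|u|) u = Θ(|v|)⁻¹ v`.
With `p_k = ∂_k v` and `q_k = Λ(|v|) |v|⁻² Re⟨v, ∂_k v⟩ v` the chain rule gives `∂_k u = Θ(|v|) (p_k
+ q_k)` and `∂_h (φ(|u|) u) = Θ(|v|)⁻¹ (p_h - q_h)`. The reciprocal factors cancel (`sesqForm_eq`),
and expanding `Re⟨𝒜^{hk} (p_k + q_k), p_h - q_h⟩` gives the integrand of `J` (`functional_eq`). What
remains is to match the two classes of functions.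

From `J` to the form: if `u` and `φ(|u|) u` are in `H¹₀`, then `v` must be shown to be in `H¹₀`.
Split `∂_k u` into its real projection on `u` and the rest. With `y = s φ'(s) / φ(s)`, passing to
`φ(|u|) u` multiplies these by `φ (1 + y)` and `φ`, passing to `v` by `√φ (1 + y/2)` and `√φ`. So
`√φ ≤ 1 + φ` and `exists_sqrt_bound` bound the gradient of `v` by those of `u` and `φ(|u|) u`;
cutoffs in `log |u|` make the argument rigorous (`exists_sqrtPhiMul_grad`).

From the form to `J`: a given `v` need not arise from such a `u`, because `Θ` and `1/Θ` may be
unbounded. The damped functions `v_ε = damp q ε |v| • v` do arise: near `0` both `t Θ(t)` and `t /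
Θ(t)` are at most a multiple of a positive power of `t` (`exists_zeta_bound`), so a large order `q`
makes `Θ(|v_ε|) v_ε` and `Θ(|v_ε|)⁻¹ v_ε` images of `v` under `C¹` maps with bounded derivative. As
`ε → 0` dominated convergence applies, thanks to `|Λ| ≤ 1` and bounds on the damping that are
uniform in `ε` (`le_functional_of_forall`).

Both parts of the theorem are the single equivalence `forall_le_sesqForm_iff`, with `κ = 0` and with
`κ > 0`. -/

/-- `u` is a limit in `L²(Ω)` of test functions whose partial derivatives converge in `L²(Ω)`
to the components of `g`. -/
structure HasH10Grad (Ω : Set (Pt N)) (u : Pt N → CVec m) (g : Fin N → Pt N → CVec m) :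
    Prop where
  memLp : MemLp u 2 (volume.restrict Ω)
  memLp_grad : ∀ k, MemLp (g k) 2 (volume.restrict Ω)
  exists_approx : ∃ f : ℕ → Pt N → CVec m, (∀ n, IsTestFunction Ω (f n)) ∧
    Tendsto (fun n => eLpNorm (fun x => f n x - u x) 2 (volume.restrict Ω)) atTop (𝓝 0) ∧
    ∀ k : Fin N, Tendsto (fun n => eLpNorm
      (fun x => classicalPartial k (f n) x - g k x) 2 (volume.restrict Ω)) atTop (𝓝 0)

/-! ### Test functions, weak derivatives and closure properties of `H¹₀`. -/

section Basic

variable {F : Type*} [NormedAddCommGroup F] [NormedSpace ℝ F]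

lemma continuous_classicalPartial {f : Pt N → F} (hf : ContDiff ℝ 1 f) (k : Fin N) :
    Continuous (classicalPartial k f) :=
  (hf.continuous_fderiv one_ne_zero).clm_apply continuous_const

lemma hasCompactSupport_classicalPartial {f : Pt N → F} (hf : HasCompactSupport f) (k : Fin N) :
    HasCompactSupport (classicalPartial k f) :=
  hf.fderiv_apply (𝕜 := ℝ) _

lemma IsTestFunction.contDiff_one {f : Pt N → F} (hf : IsTestFunction Ω f) : ContDiff ℝ 1 f :=
  hf.1.of_le (by exact_mod_cast le_top)

lemma memLp_two_of_continuous {F : Type*} [NormedAddCommGroup F] {f : Pt N → F} (hf : Continuous f) (hc : HasCompactSupport f) :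
    MemLp f 2 (volume.restrict Ω) :=
  (hf.memLp_of_hasCompactSupport hc).restrict Ω

lemma memLp_classicalPartial {f : Pt N → F} (hf : ContDiff ℝ 1 f) (hc : HasCompactSupport f)
    (k : Fin N) : MemLp (classicalPartial k f) 2 (volume.restrict Ω) :=
  memLp_two_of_continuous (continuous_classicalPartial hf k)
    (hasCompactSupport_classicalPartial hc k)

lemma locallyIntegrableOn_of_memLp {F : Type*} [NormedAddCommGroup F] (hΩ : IsOpen Ω) {f : Pt N → F}
    (hf : MemLp f 2 (volume.restrict Ω)) : LocallyIntegrableOn f Ω := by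
  rw [locallyIntegrableOn_iff hΩ.isLocallyClosed]
  intro K hK hKc
  have h1 : MemLp f 2 (volume.restrict K) := hf.mono_measure (Measure.restrict_mono hK le_rfl)
  have : IsFiniteMeasure (volume.restrict K) := ⟨by simpa using hKc.measure_lt_top⟩
  exact h1.integrable (by norm_num)

/-- Integration by parts for `C¹` functions, one of them with compact support in `Ω`. -/
lemma integral_classicalPartial_smul {η : Pt N → ℝ} (hη : IsTestFunction Ω η) {f : Pt N → F}
    (hf : ContDiff ℝ 1 f) (k : Fin N) :
    ∫ x in Ω, classicalPartial k η x • f x = - ∫ x in Ω, η x • classicalPartial k f x := by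
  have hη1 := hη.contDiff_one
  have hsupp : Function.support η ⊆ Ω := (subset_tsupport η).trans hη.2.2
  have hsupp' : Function.support (classicalPartial k η) ⊆ Ω :=
    ((Function.support_subset_iff').2 fun x hx => by
      simp [classicalPartial, fderiv_of_notMem_tsupport (𝕜 := ℝ) (fun h => hx (hη.2.2 h))])
  rw [setIntegral_eq_integral_of_forall_compl_eq_zero,
    setIntegral_eq_integral_of_forall_compl_eq_zero]
  · have := integral_bilinear_fderiv_right_eq_neg_left_of_integrable (μ := volume) (f := η) (g := f)
      (v := EuclideanSpace.single k (1 : ℝ)) (B := ContinuousLinearMap.lsmul ℝ ℝ)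
      (((continuous_classicalPartial hη1 k).smul hf.continuous).integrable_of_hasCompactSupport
        (hasCompactSupport_classicalPartial hη.2.1 k).smul_right)
      ((hη.1.continuous.smul (continuous_classicalPartial hf k)).integrable_of_hasCompactSupport
        hη.2.1.smul_right)
      ((hη.1.continuous.smul hf.continuous).integrable_of_hasCompactSupport hη.2.1.smul_right)
      (fun x _ => hη1.differentiable one_ne_zero x) (fun x _ => hf.differentiable one_ne_zero x)
    simp only [ContinuousLinearMap.lsmul_apply] at this
    simp only [classicalPartial]
    rw [this, neg_neg]
  · intro x hx
    rw [Function.notMem_support.1 fun h => hx (hsupp h), zero_smul]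
  · intro x hx
    rw [Function.notMem_support.1 fun h => hx (hsupp' h), zero_smul]

/-- By Cauchy–Schwarz; this carries integration by parts from test functions to their `L²` limits.
-/
lemma tendsto_integral_smul {μ : Measure (Pt N)} {ψ : Pt N → ℝ} (hψ : MemLp ψ 2 μ)
    {f : ℕ → Pt N → F} {u : Pt N → F} (hf : ∀ n, MemLp (f n) 2 μ) (hu : MemLp u 2 μ)
    (h : Tendsto (fun n => eLpNorm (fun x => f n x - u x) 2 μ) atTop (𝓝 0)) :
    Tendsto (fun n => ∫ x, ψ x • f n x ∂μ) atTop (𝓝 (∫ x, ψ x • u x ∂μ)) := by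
  have hint : ∀ {w : Pt N → F}, MemLp w 2 μ → Integrable (fun x => ψ x • w x) μ := by
    intro w hw
    exact memLp_one_iff_integrable.1 (hw.smul (r := 1) hψ)
  refine tendsto_integral_of_L1' _ (hint hu).aestronglyMeasurable
    (Eventually.of_forall fun n => hint (hf n)) ?_
  have hle : ∀ n, eLpNorm ((fun x => ψ x • f n x) - fun x => ψ x • u x) 1 μ
      ≤ eLpNorm ψ 2 μ * eLpNorm (fun x => f n x - u x) 2 μ := by
    intro n
    have := eLpNorm_smul_le_mul_eLpNorm (p := 2) (q := 2) (r := 1)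
      ((hf n).sub hu).aestronglyMeasurable hψ.aestronglyMeasurable
    refine le_trans (le_of_eq ?_) this
    congr 1
    ext x
    simp [smul_sub]
  refine tendsto_of_tendsto_of_tendsto_of_le_of_le tendsto_const_nhds ?_ (fun _ => zero_le) hle
  simpa using ENNReal.Tendsto.const_mul h (Or.inr hψ.eLpNorm_ne_top)

end Basic

namespace HasH10Grad

variable {u v : Pt N → CVec m} {g : Fin N → Pt N → CVec m}

lemma isWeakPartial (hΩ : IsOpen Ω) (h : HasH10Grad Ω u g) (k : Fin N) :
    IsWeakPartial Ω k u (g k) := by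
  obtain ⟨f, hf, hfu, hfg⟩ := h.exists_approx
  refine ⟨locallyIntegrableOn_of_memLp hΩ h.memLp,
    locallyIntegrableOn_of_memLp hΩ (h.memLp_grad k), fun η hη => ?_⟩
  have h1 := tendsto_integral_smul (memLp_classicalPartial (Ω := Ω) hη.contDiff_one hη.2.1 k)
    (fun n => memLp_two_of_continuous (hf n).1.continuous (hf n).2.1) h.memLp hfu
  have h2 := tendsto_integral_smul (memLp_two_of_continuous (Ω := Ω) hη.1.continuous hη.2.1)
    (fun n => memLp_classicalPartial (hf n).contDiff_one (hf n).2.1 k) (h.memLp_grad k) (hfg k)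
  simp only [fun n => integral_classicalPartial_smul hη (hf n).contDiff_one k] at h1
  exact tendsto_nhds_unique h1 h2.neg

end HasH10Grad

/-- The fundamental lemma of the calculus of variations. It makes the arbitrary choice in
`weakPartial` harmless and lets gradients be identified by computing them in two ways. -/
lemma IsWeakPartial.ae_eq (hΩ : IsOpen Ω) {k : Fin N} {u g g' : Pt N → CVec m}
    (h : IsWeakPartial Ω k u g) (h' : IsWeakPartial Ω k u g') :
    g =ᵐ[volume.restrict Ω] g' := by
  have key : ∀ᵐ x, x ∈ Ω → (g - g') x = 0 := by
    refine hΩ.ae_eq_zero_of_integral_contDiff_smul_eq_zero (h.2.1.sub h'.2.1) ?_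
    intro η hη hc hs
    have hint : ∀ {w : Pt N → CVec m}, LocallyIntegrableOn w Ω →
        Integrable (fun x => η x • w x) (volume.restrict Ω) := by
      intro w hw
      have h1 : IntegrableOn (fun x => η x • w x) (tsupport η) :=
        (hw.integrableOn_compact_subset hs hc).continuousOn_smul hη.continuous.continuousOn hc
      refine ((integrableOn_iff_integrable_of_support_subset ?_).1 h1).integrableOn
      exact (Function.support_smul_subset_left η w).trans (subset_tsupport η)
    have e1 := h.2.2 η ⟨hη, hc, hs⟩
    have e2 := h'.2.2 η ⟨hη, hc, hs⟩
    rw [e1, neg_inj] at e2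
    have : ∫ x, η x • (g - g') x = ∫ x in Ω, η x • (g - g') x := by
      rw [setIntegral_eq_integral_of_forall_compl_eq_zero]
      intro x hx
      rw [image_eq_zero_of_notMem_tsupport (fun h => hx (hs h)), zero_smul]
    rw [this]
    simp only [Pi.sub_apply, smul_sub]
    rw [integral_sub (hint h.2.1) (hint h'.2.1), e2, sub_self]
  rw [EventuallyEq, ae_restrict_iff' hΩ.measurableSet]
  filter_upwards [key] with x hx hxΩ
  exact sub_eq_zero.1 (hx hxΩ)

lemma isWeakPartial_weakPartial {k : Fin N} {u g : Pt N → CVec m} (h : IsWeakPartial Ω k u g) :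
    IsWeakPartial Ω k u (weakPartial Ω k u) := by
  have hex : ∃ g, IsWeakPartial Ω k u g := ⟨g, h⟩
  rw [weakPartial, dif_pos hex]
  exact hex.choose_spec

lemma MemH10.hasH10Grad (hΩ : IsOpen Ω) {u : Pt N → CVec m} (h : MemH10 Ω u) :
    HasH10Grad Ω u (fun k => weakPartial Ω k u) := by
  refine ⟨h.1.1, fun k => ?_, h.2⟩
  obtain ⟨g, hg, hg2⟩ := h.1.2 k
  exact hg2.ae_eq (hg.ae_eq hΩ (isWeakPartial_weakPartial hg))

namespace HasH10Grad

variable {u v : Pt N → CVec m} {g g' : Fin N → Pt N → CVec m}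

lemma weakPartial_ae_eq (hΩ : IsOpen Ω) (h : HasH10Grad Ω u g) (k : Fin N) :
    weakPartial Ω k u =ᵐ[volume.restrict Ω] g k :=
  (isWeakPartial_weakPartial (h.isWeakPartial hΩ k)).ae_eq hΩ (h.isWeakPartial hΩ k)

lemma ae_unique (hΩ : IsOpen Ω) (h : HasH10Grad Ω u g) (h' : HasH10Grad Ω u g') (k : Fin N) :
    g k =ᵐ[volume.restrict Ω] g' k :=
  (h.isWeakPartial hΩ k).ae_eq hΩ (h'.isWeakPartial hΩ k)

lemma congr (h : HasH10Grad Ω u g) (hu : u =ᵐ[volume.restrict Ω] v)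
    (hg : ∀ k, g k =ᵐ[volume.restrict Ω] g' k) : HasH10Grad Ω v g' := by
  obtain ⟨f, hf, hfu, hfg⟩ := h.exists_approx
  refine ⟨h.memLp.ae_eq hu, fun k => (h.memLp_grad k).ae_eq (hg k), f, hf, ?_, fun k => ?_⟩
  · refine hfu.congr fun n => eLpNorm_congr_ae ?_
    filter_upwards [hu] with x hx
    rw [hx]
  · refine (hfg k).congr fun n => eLpNorm_congr_ae ?_
    filter_upwards [hg k] with x hx
    rw [hx]

lemma memH10 (hΩ : IsOpen Ω) (h : HasH10Grad Ω u g) : MemH10 Ω u :=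
  ⟨⟨h.memLp, fun k => ⟨g k, h.isWeakPartial hΩ k, h.memLp_grad k⟩⟩,
    (h.congr .rfl fun k => (h.weakPartial_ae_eq hΩ k).symm).exists_approx⟩

/-- Limits in the `H¹` norm of elements of `H¹₀`. -/
lemma of_tendsto {un : ℕ → Pt N → CVec m} {gn : ℕ → Fin N → Pt N → CVec m}
    (h : ∀ n, HasH10Grad Ω (un n) (gn n)) (hu : MemLp u 2 (volume.restrict Ω))
    (hg : ∀ k, MemLp (g k) 2 (volume.restrict Ω))
    (hun : Tendsto (fun n => eLpNorm (fun x => un n x - u x) 2 (volume.restrict Ω)) atTop (𝓝 0))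
    (hgn : ∀ k, Tendsto (fun n => eLpNorm (fun x => gn n k x - g k x) 2 (volume.restrict Ω))
      atTop (𝓝 0)) : HasH10Grad Ω u g := by
  have key : ∀ n : ℕ, ∃ f : Pt N → CVec m, IsTestFunction Ω f ∧
      eLpNorm (fun x => f x - un n x) 2 (volume.restrict Ω) ≤ ((n : ENNReal))⁻¹ ∧
      ∀ k, eLpNorm (fun x => classicalPartial k f x - gn n k x) 2 (volume.restrict Ω)
        ≤ (n : ENNReal)⁻¹ := by
    intro n
    obtain ⟨f, hf, hfu, hfg⟩ := (h n).exists_approx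
    -- The tolerance is `⊤` at `n = 0`, which is harmless for the limit.
    have hpos : (0 : ENNReal) < (n : ENNReal)⁻¹ := by simp
    have := (hfu.eventually_le_const hpos).and
      (eventually_all.2 fun k => (hfg k).eventually_le_const hpos)
    obtain ⟨j, hj⟩ := this.exists
    exact ⟨f j, hf j, hj⟩
  choose f hf hfu hfg using key
  have hlim : Tendsto (fun n : ℕ => (n : ENNReal)⁻¹) atTop (𝓝 0) :=
    ENNReal.tendsto_inv_nat_nhds_zero
  refine ⟨hu, hg, f, hf, ?_, fun k => ?_⟩
  · refine tendsto_of_tendsto_of_tendsto_of_le_of_le tendsto_const_nhds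
      (by simpa using hlim.add hun) (fun _ => zero_le) fun n => ?_
    refine le_trans ?_ (add_le_add_left (hfu n) _)
    refine le_trans (le_of_eq ?_) (eLpNorm_add_le
      ((memLp_two_of_continuous (hf n).1.continuous (hf n).2.1).sub
        (h n).memLp).aestronglyMeasurable
      ((h n).memLp.sub hu).aestronglyMeasurable (by norm_num))
    congr 1
    ext1 x
    simp
  · refine tendsto_of_tendsto_of_tendsto_of_le_of_le tendsto_const_nhds
      (by simpa using hlim.add (hgn k)) (fun _ => zero_le) fun n => ?_
    refine le_trans ?_ (add_le_add_left (hfg n k) _)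
    refine le_trans (le_of_eq ?_) (eLpNorm_add_le
      ((memLp_classicalPartial (hf n).contDiff_one (hf n).2.1 k).sub
        ((h n).memLp_grad k)).aestronglyMeasurable
      (((h n).memLp_grad k).sub (hg k)).aestronglyMeasurable (by norm_num))
    congr 1
    ext1 x
    simp

end HasH10Grad

/-! ### Dominated convergence in `L²` and in `H¹₀`. -/

section Dominated

variable {α F : Type*} [MeasurableSpace α] [NormedAddCommGroup F] {μ : Measure α}

/-- Dominated convergence in `L²`. -/
lemma tendsto_eLpNorm_two_of_dominated {f : ℕ → α → F} {u : α → F} {B : α → ℝ}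
    (hf : ∀ n, AEStronglyMeasurable (f n) μ) (hB : MemLp B 2 μ)
    (hbound : ∀ n, ∀ᵐ x ∂μ, ‖f n x‖ ≤ B x)
    (hlim : ∀ᵐ x ∂μ, Tendsto (fun n => f n x) atTop (𝓝 (u x))) :
    MemLp u 2 μ ∧ Tendsto (fun n => eLpNorm (fun x => f n x - u x) 2 μ) atTop (𝓝 0) := by
  have hum : AEStronglyMeasurable u μ := aestronglyMeasurable_of_tendsto_ae atTop hf hlim
  have huB : ∀ᵐ x ∂μ, ‖u x‖ ≤ B x := by
    filter_upwards [ae_all_iff.2 hbound, hlim] with x hx hl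
    exact le_of_tendsto' hl.norm hx
  have hu : MemLp u 2 μ := hB.mono hum (huB.mono fun x hx => hx.trans (le_abs_self _))
  refine ⟨hu, ?_⟩
  -- The limit is also bounded by `B`, so the squared difference is at most `(2 B)²`.
  have hint : Integrable (fun x => 4 * B x ^ 2) μ := hB.integrable_sq.const_mul 4
  have hle : ∀ n, ∀ᵐ x ∂μ, ‖(‖f n x - u x‖ ^ 2 : ℝ)‖ ≤ 4 * B x ^ 2 := by
    intro n
    filter_upwards [hbound n, huB] with x h1 h2
    have h3 : ‖f n x - u x‖ ≤ 2 * B x := (norm_sub_le _ _).trans (by linarith)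
    rw [Real.norm_of_nonneg (by positivity)]
    nlinarith [norm_nonneg (f n x - u x)]
  have hl0 : ∀ᵐ x ∂μ, Tendsto (fun n => (‖f n x - u x‖ ^ 2 : ℝ)) atTop (𝓝 0) := by
    filter_upwards [hlim] with x hx
    have := ((hx.sub_const (u x)).norm.pow 2)
    simpa using this
  have hmeas : ∀ n, AEStronglyMeasurable (fun x => (‖f n x - u x‖ ^ 2 : ℝ)) μ := fun n =>
    ((hf n).sub hum).norm.pow 2
  have := tendsto_integral_of_dominated_convergence _ hmeas hint hle hl0
  simp only [integral_zero] at this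
  have hsq : ∀ n, eLpNorm (fun x => f n x - u x) 2 μ
      = ENNReal.ofReal ((∫ x, ‖f n x - u x‖ ^ 2 ∂μ) ^ (1 / 2 : ℝ)) := by
    intro n
    have hm : MemLp (fun x => f n x - u x) 2 μ :=
      (hB.mono (hf n) ((hbound n).mono fun x hx => hx.trans (le_abs_self _))).sub hu
    rw [hm.eLpNorm_eq_integral_rpow_norm (by norm_num) (by norm_num)]
    simp
  simp only [hsq]
  have h0 := (this.rpow_const (p := (1 / 2 : ℝ)) (Or.inr (by norm_num)))
  rw [Real.zero_rpow (by norm_num)] at h0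
  simpa using ENNReal.tendsto_ofReal h0

end Dominated

/-- Dominated almost everywhere limits of elements of `H¹₀`. -/
lemma HasH10Grad.of_dominated {u : Pt N → CVec m} {g : Fin N → Pt N → CVec m}
    {un : ℕ → Pt N → CVec m} {gn : ℕ → Fin N → Pt N → CVec m}
    {B : Pt N → ℝ} {B' : Fin N → Pt N → ℝ}
    (h : ∀ n, HasH10Grad Ω (un n) (gn n)) (hB : MemLp B 2 (volume.restrict Ω))
    (hB' : ∀ k, MemLp (B' k) 2 (volume.restrict Ω))
    (hun : ∀ n, ∀ᵐ x ∂(volume.restrict Ω), ‖un n x‖ ≤ B x)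
    (hgn : ∀ n k, ∀ᵐ x ∂(volume.restrict Ω), ‖gn n k x‖ ≤ B' k x)
    (hlim : ∀ᵐ x ∂(volume.restrict Ω), Tendsto (fun n => un n x) atTop (𝓝 (u x)))
    (hlim' : ∀ k, ∀ᵐ x ∂(volume.restrict Ω), Tendsto (fun n => gn n k x) atTop (𝓝 (g k x))) :
    HasH10Grad Ω u g := by
  have h1 := tendsto_eLpNorm_two_of_dominated (fun n => (h n).memLp.aestronglyMeasurable) hB hun
    hlim
  have h2 := fun k => tendsto_eLpNorm_two_of_dominated
    (fun n => ((h n).memLp_grad k).aestronglyMeasurable) (hB' k) (fun n => hgn n k) (hlim' k)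
  exact .of_tendsto h h1.1 (fun k => (h2 k).1) h1.2 fun k => (h2 k).2

/-! ### Mollification and the `C¹` chain rule in `H¹₀`. -/

section Mollification

open ContinuousLinearMap

/-- Mollifications of a continuous function with compact support converge in `L²`. -/
lemma tendsto_eLpNorm_mollify {g : Pt N → CVec m} (hg : Continuous g) {K : Set (Pt N)}
    (hK : IsCompact K) (hgK : ∀ x, x ∉ K → g x = 0)
    {ρ : ℕ → ContDiffBump (0 : Pt N)} (hρ : Tendsto (fun n => (ρ n).rOut) atTop (𝓝 0))
    (hρK : ∀ n x, x ∉ K → convolution ((ρ n).normed volume) g (lsmul ℝ ℝ) volume x = 0) :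
    Tendsto (fun n => eLpNorm (fun x =>
      convolution ((ρ n).normed volume) g (lsmul ℝ ℝ) volume x - g x) 2 (volume.restrict Ω))
      atTop (𝓝 0) := by
  have hgc : HasCompactSupport g := HasCompactSupport.intro hK hgK
  obtain ⟨M, hM⟩ := hgc.exists_bound_of_continuous hg
  have hB : MemLp (K.indicator fun _ => 3 * M) 2 (volume.restrict Ω) :=
    (memLp_indicator_const 2 hK.measurableSet _ (Or.inr hK.measure_lt_top.ne)).restrict Ω
  refine (tendsto_eLpNorm_two_of_dominated (fun n => ?_) hB (fun n => .of_forall fun x => ?_)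
    (.of_forall fun x => ContDiffBump.convolution_tendsto_right_of_continuous hρ hg x)).2
  · exact ((HasCompactSupport.contDiff_convolution_left (n := 0) (lsmul ℝ ℝ)
      (ρ n).hasCompactSupport_normed (ρ n).contDiff_normed
      hg.locallyIntegrable).continuous.aestronglyMeasurable)
  · by_cases hx : x ∈ K
    · rw [indicator_of_mem hx]
      have h1 : dist (convolution ((ρ n).normed volume) g (lsmul ℝ ℝ) volume x) (g x)
          ≤ 2 * M := by
        refine (ρ n).dist_normed_convolution_le hg.aestronglyMeasurable fun y _ => ?_
        rw [dist_eq_norm]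
        exact (norm_sub_le _ _).trans (by linarith [hM x, hM y])
      rw [dist_eq_norm] at h1
      have h2 := norm_sub_norm_le (convolution ((ρ n).normed volume) g (lsmul ℝ ℝ) volume x) (g x)
      linarith [hM x]
    · rw [hρK n x hx, norm_zero, indicator_of_notMem hx]

/-- A `C¹` function with compact support in `Ω` belongs to `H¹₀(Ω)`. -/
lemma hasH10Grad_of_contDiff (hΩ : IsOpen Ω) {f : Pt N → CVec m} (hf : ContDiff ℝ 1 f)
    (hc : HasCompactSupport f) (hs : tsupport f ⊆ Ω) :
    HasH10Grad Ω f (fun k => classicalPartial k f) := by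
  refine ⟨memLp_two_of_continuous hf.continuous hc, fun k => memLp_classicalPartial hf hc k, ?_⟩
  obtain ⟨δ, hδ, hδΩ⟩ := IsCompact.exists_cthickening_subset_open hc hΩ hs
  set K := Metric.cthickening δ (tsupport f) with hKdef
  have hK : IsCompact K := IsCompact.cthickening hc
  have hfK : tsupport f ⊆ K := Metric.self_subset_cthickening _
  -- Outer radii at most `δ` keep the supports of all mollifications inside `K`, hence inside `Ω`.
  let ρ : ℕ → ContDiffBump (0 : Pt N) := fun n =>
    ⟨δ / (n + 2), δ / (n + 1), by positivity, by gcongr; norm_num⟩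
  have hρ0 : Tendsto (fun n => (ρ n).rOut) atTop (𝓝 0) := by
    simpa [ρ, div_eq_mul_one_div δ] using
      (tendsto_one_div_add_atTop_nhds_zero_nat (𝕜 := ℝ)).const_mul δ
  have hzero : ∀ {g : Pt N → CVec m}, Function.support g ⊆ tsupport f → ∀ n x, x ∉ K →
      convolution ((ρ n).normed volume) g (lsmul ℝ ℝ) volume x = 0 := by
    intro g hg n x hx
    by_contra hne
    obtain ⟨a, ha, b, hb, rfl⟩ := support_convolution_subset (lsmul ℝ ℝ) hne
    refine hx (Metric.mem_cthickening_of_dist_le _ b _ _ (hg hb) ?_)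
    rw [(ρ n).support_normed_eq, mem_ball_zero_iff] at ha
    have : (ρ n).rOut ≤ δ := div_le_self hδ.le (by linarith [n.cast_nonneg (α := ℝ)])
    simpa [dist_eq_norm] using ha.le.trans this
  have hpart : ∀ k, Function.support (classicalPartial k f) ⊆ tsupport f := fun k =>
    Function.support_subset_iff'.2 fun x hx => by
      simp [classicalPartial, fderiv_of_notMem_tsupport (𝕜 := ℝ) hx]
  have hconv : ∀ n k x, classicalPartial k (convolution ((ρ n).normed volume) f (lsmul ℝ ℝ) volume)
      x = convolution ((ρ n).normed volume) (classicalPartial k f) (lsmul ℝ ℝ) volume x := by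
    intro n k x
    have hli : LocallyIntegrable ((ρ n).normed volume) (volume : Measure (Pt N)) :=
      (ρ n).continuous_normed.locallyIntegrable
    rw [classicalPartial, (hc.hasFDerivAt_convolution_right (lsmul ℝ ℝ) hli hf x).fderiv,
      convolution_precompR_apply (lsmul ℝ ℝ) hli (hc.fderiv ℝ)
      (hf.continuous_fderiv one_ne_zero)]
    rfl
  refine ⟨fun n => convolution ((ρ n).normed volume) f (lsmul ℝ ℝ) volume, fun n => ⟨?_, ?_, ?_⟩,
    ?_, fun k => ?_⟩
  · exact HasCompactSupport.contDiff_convolution_left (lsmul ℝ ℝ)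
      (ρ n).hasCompactSupport_normed (ρ n).contDiff_normed hf.continuous.locallyIntegrable
  · exact HasCompactSupport.intro hK (hzero (subset_tsupport f) n)
  · refine (closure_minimal ?_ hK.isClosed).trans hδΩ
    exact Function.support_subset_iff'.2 (hzero (subset_tsupport f) n)
  · exact tendsto_eLpNorm_mollify hf.continuous hK
      (fun x hx => image_eq_zero_of_notMem_tsupport fun h => hx (hfK h)) hρ0
      (hzero (subset_tsupport f))
  · simp only [hconv]
    exact tendsto_eLpNorm_mollify (continuous_classicalPartial hf k) hK
      (fun x hx => Function.notMem_support.1 fun h => hx (hfK (hpart k h))) hρ0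
      (hzero (hpart k))

end Mollification

/-- The chain rule in `H¹₀` for `C¹` maps with bounded derivative vanishing at the origin. -/
lemma HasH10Grad.comp (hΩ : IsOpen Ω) {u : Pt N → CVec m} {g : Fin N → Pt N → CVec m}
    (h : HasH10Grad Ω u g) {G : CVec m → CVec m} (hG : ContDiff ℝ 1 G) (hG0 : G 0 = 0) {M : ℝ}
    (hM : ∀ z, ‖fderiv ℝ G z‖ ≤ M) :
    HasH10Grad Ω (fun x => G (u x)) (fun k x => fderiv ℝ G (u x) (g k x)) := by
  have hGc : Continuous G := hG.continuous
  have hDc : Continuous (fderiv ℝ G) := hG.continuous_fderiv one_ne_zero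
  have hlip : ∀ z w, ‖G z - G w‖ ≤ M * ‖z - w‖ := fun z w =>
    convex_univ.norm_image_sub_le_of_norm_fderiv_le
      (fun x _ => hG.differentiable one_ne_zero x) (fun x _ => hM x) (mem_univ w) (mem_univ z)
  have hDle : ∀ z w, ‖fderiv ℝ G z w‖ ≤ M * ‖w‖ := fun z w =>
    ((fderiv ℝ G z).le_opNorm w).trans (by gcongr; exact hM z)
  have hmeas : ∀ {a b : Pt N → CVec m}, AEStronglyMeasurable a (volume.restrict Ω) →
      AEStronglyMeasurable b (volume.restrict Ω) →
      AEStronglyMeasurable (fun x => fderiv ℝ G (a x) (b x)) (volume.restrict Ω) :=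
    fun ha hb => (hDc.fst'.clm_apply continuous_snd : Continuous
      fun p : CVec m × CVec m => fderiv ℝ G p.1 p.2).comp_aestronglyMeasurable (ha.prodMk hb)
  have hu2 : MemLp (fun x => G (u x)) 2 (volume.restrict Ω) :=
    h.memLp.of_le_mul (c := M) (hGc.comp_aestronglyMeasurable h.memLp.aestronglyMeasurable)
      (.of_forall fun x => by simpa [hG0] using hlip (u x) 0)
  have hg2 : ∀ k, MemLp (fun x => fderiv ℝ G (u x) (g k x)) 2 (volume.restrict Ω) := fun k =>
    (h.memLp_grad k).of_le_mul (c := M)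
      (hmeas h.memLp.aestronglyMeasurable (h.memLp_grad k).aestronglyMeasurable)
      (.of_forall fun x => hDle _ _)
  obtain ⟨f₀, hf₀, hfu₀, hfg₀⟩ := h.exists_approx
  -- A subsequence converging almost everywhere is needed for `DG(f n) → DG(u)` pointwise.
  obtain ⟨ns, hns, hae⟩ := (tendstoInMeasure_of_tendsto_eLpNorm (two_ne_zero)
    (fun n => (memLp_two_of_continuous (Ω := Ω) (hf₀ n).1.continuous
      (hf₀ n).2.1).aestronglyMeasurable) h.memLp.aestronglyMeasurable hfu₀).exists_seq_tendsto_ae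
  set f := fun n => f₀ (ns n) with hfdef
  have hf : ∀ n, IsTestFunction Ω (f n) := fun n => hf₀ _
  have hfu := hfu₀.comp hns.tendsto_atTop
  have hfg := fun k => (hfg₀ k).comp hns.tendsto_atTop
  have hM0 : 0 ≤ M := (norm_nonneg _).trans (hM 0)
  have hmul : ∀ {s : ℕ → ENNReal}, Tendsto s atTop (𝓝 0) →
      Tendsto (fun n => ENNReal.ofReal M * s n) atTop (𝓝 0) := fun hs => by
    simpa using ENNReal.Tendsto.const_mul hs (Or.inr ENNReal.ofReal_ne_top)
  have hpart : ∀ n k x, classicalPartial k (fun x => G (f n x)) x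
      = fderiv ℝ G (f n x) (classicalPartial k (f n) x) := by
    intro n k x
    have h1 := (hG.differentiable one_ne_zero (f n x)).hasFDerivAt.comp x
      ((hf n).contDiff_one.differentiable one_ne_zero x).hasFDerivAt
    change fderiv ℝ (G ∘ f n) x _ = _
    rw [h1.fderiv]
    rfl
  refine HasH10Grad.of_tendsto (un := fun n x => G (f n x))
    (gn := fun n k x => fderiv ℝ G (f n x) (classicalPartial k (f n) x)) (fun n => ?_) hu2 hg2 ?_ ?_
  · have hsub : Function.support (fun x => G (f n x)) ⊆ Function.support (f n) := fun x hx hx0 =>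
      hx (by simp only [hx0, hG0])
    have hsub' : tsupport (fun x => G (f n x)) ⊆ tsupport (f n) := closure_mono hsub
    refine (hasH10Grad_of_contDiff hΩ (hG.comp (hf n).contDiff_one) ?_
      (hsub'.trans (hf n).2.2)).congr .rfl fun k => .of_forall (hpart n k)
    exact (hf n).2.1.comp_left hG0
  · refine tendsto_of_tendsto_of_tendsto_of_le_of_le tendsto_const_nhds (hmul hfu)
      (fun _ => zero_le) fun n => ?_
    exact eLpNorm_le_mul_eLpNorm_of_ae_le_mul (.of_forall fun x => hlip _ _) _
  · intro k
    have hmf : ∀ n, MemLp (classicalPartial k (f n)) 2 (volume.restrict Ω) := fun n =>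
      memLp_classicalPartial (hf n).contDiff_one (hf n).2.1 k
    have hfm : ∀ n, AEStronglyMeasurable (f n) (volume.restrict Ω) := fun n =>
      (hf n).1.continuous.aestronglyMeasurable
    have hgk := h.memLp_grad k
    have h1 := (tendsto_eLpNorm_two_of_dominated (μ := volume.restrict Ω)
      (f := fun n x => fderiv ℝ G (f n x) (g k x)) (u := fun x => fderiv ℝ G (u x) (g k x))
      (B := fun x => M * ‖g k x‖) (fun n => hmeas (hfm n) hgk.aestronglyMeasurable)
      (hgk.norm.const_mul M) (fun n => .of_forall fun x => hDle _ _) (by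
        filter_upwards [hae] with x hx
        have hx' : Tendsto (fun n => fderiv ℝ G (f n x)) atTop (𝓝 (fderiv ℝ G (u x))) :=
          (hDc.tendsto (u x)).comp hx
        exact ((ContinuousLinearMap.apply ℝ (CVec m) (g k x)).continuous.tendsto _).comp hx')).2
    -- Split `DG(f n) ∂f n - DG(u) g = DG(f n) (∂f n - g) + (DG(f n) - DG(u)) g`: the first term is
    -- small because `DG` is bounded, the second is `h1`.
    refine tendsto_of_tendsto_of_tendsto_of_le_of_le tendsto_const_nhds
      (by simpa using (hmul (hfg k)).add h1) (fun _ => zero_le) fun n => ?_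
    refine le_trans ?_ (add_le_add_left (eLpNorm_le_mul_eLpNorm_of_ae_le_mul
      (f := fun x => fderiv ℝ G (f n x) (classicalPartial k (f n) x - g k x))
      (.of_forall fun x => hDle _ _) _) _)
    refine le_trans (le_of_eq ?_) (eLpNorm_add_le
      (hmeas (hfm n) ((hmf n).sub hgk).aestronglyMeasurable)
      ((hmeas (hfm n) hgk.aestronglyMeasurable).sub (hg2 k).aestronglyMeasurable) (by norm_num))
    congr 1
    ext1 x
    simp

/-! ### Radial maps `z ↦ b(|z|) z`. -/

section Radial

variable {E : Type*} [NormedAddCommGroup E] [InnerProductSpace ℝ E]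

/-- The real orthogonal projection onto the line spanned by `z`. -/
noncomputable def radProj (z : E) : E →L[ℝ] E := (‖z‖ ^ 2)⁻¹ • (innerSL ℝ z).smulRight z

lemma radProj_apply (z h : E) : radProj z h = ((‖z‖ ^ 2)⁻¹ * inner ℝ z h) • z := by
  simp [radProj, smul_smul]

@[simp] lemma radProj_zero : radProj (0 : E) = 0 := by
  ext h
  simp [radProj_apply]

lemma norm_radProj_apply_le (z h : E) : ‖radProj z h‖ ≤ ‖h‖ := by
  rcases eq_or_ne z 0 with rfl | hz
  · simp
  have hz' : 0 < ‖z‖ := norm_pos_iff.2 hz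
  rw [radProj_apply, norm_smul, norm_mul, norm_inv, norm_pow, norm_norm, Real.norm_eq_abs]
  have := abs_real_inner_le_norm z h
  calc (‖z‖ ^ 2)⁻¹ * |inner ℝ z h| * ‖z‖ ≤ (‖z‖ ^ 2)⁻¹ * (‖z‖ * ‖h‖) * ‖z‖ := by gcongr
    _ = ‖h‖ := by field_simp

lemma norm_radProj_le (z : E) : ‖radProj z‖ ≤ 1 :=
  ContinuousLinearMap.opNorm_le_bound _ zero_le_one fun h => by
    simpa using norm_radProj_apply_le z h

lemma radProj_self (z : E) : radProj z z = z := by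
  rcases eq_or_ne z 0 with rfl | hz
  · simp
  rw [radProj_apply, real_inner_self_eq_norm_sq,
    inv_mul_cancel₀ (pow_ne_zero 2 (norm_ne_zero_iff.2 hz)), one_smul]

lemma radProj_radProj (z h : E) : radProj z (radProj z h) = radProj z h := by
  conv_lhs => rw [radProj_apply z h, map_smul, radProj_self]
  rw [radProj_apply]

lemma radProj_smul {a : ℝ} (ha : a ≠ 0) (z : E) : radProj (a • z) = radProj z := by
  ext h
  simp only [radProj_apply, norm_smul, inner_smul_left, smul_smul, Real.norm_eq_abs, mul_pow,
    sq_abs]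
  congr 1
  simp only [conj_trivial, mul_inv]
  field_simp

lemma continuousAt_radProj {z : E} (hz : z ≠ 0) : ContinuousAt (radProj : E → E →L[ℝ] E) z := by
  have h1 : ContinuousAt (fun z : E => (‖z‖ ^ 2)⁻¹) z :=
    (continuous_norm.pow 2).continuousAt.inv₀ (pow_ne_zero 2 (norm_ne_zero_iff.2 hz))
  have h2 : Continuous fun z : E => (innerSL ℝ z).smulRight z := by fun_prop
  exact h1.smul h2.continuousAt

/-- `b` and `c = t b'(t)` are profiles for which the radial map `z ↦ b(|z|) z` is `C¹` with
bounded derivative, flat at the origin. -/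
structure RadialProfile (b c : ℝ → ℝ) : Prop where
  hasDerivAt : ∀ t, 0 < t → HasDerivAt b (c t / t) t
  continuousOn : ContinuousOn c (Ioi 0)
  bound : ∃ C, ∀ t, 0 < t → |b t| ≤ C ∧ |b t| ≤ C * t ∧ |c t| ≤ C ∧ |c t| ≤ C * t

open Classical in
/-- The derivative of the radial map `z ↦ b(|z|) z`, where `c = t b'(t)`. -/
noncomputable def radialDeriv (b c : ℝ → ℝ) (z : E) : E →L[ℝ] E :=
  if z = 0 then 0 else b ‖z‖ • ContinuousLinearMap.id ℝ E + c ‖z‖ • radProj z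

lemma radialDeriv_of_ne {b c : ℝ → ℝ} {z : E} (hz : z ≠ 0) (h : E) :
    radialDeriv b c z h = b ‖z‖ • h + c ‖z‖ • radProj z h := by
  simp [radialDeriv, hz]

lemma hasFDerivAt_norm {z : E} (hz : z ≠ 0) :
    HasFDerivAt (fun z : E => ‖z‖) (‖z‖⁻¹ • innerSL ℝ z) z := by
  have h := (hasStrictFDerivAt_norm_sq z).hasFDerivAt.sqrt
    (pow_ne_zero 2 (norm_ne_zero_iff.2 hz))
  simp only [Real.sqrt_sq (norm_nonneg _)] at h
  convert h using 1
  ext w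
  have : ‖z‖ ≠ 0 := norm_ne_zero_iff.2 hz
  simp
  field_simp

lemma hasFDerivAt_radial_of_ne {b c : ℝ → ℝ} {z : E} (hz : z ≠ 0)
    (hb : HasDerivAt b (c ‖z‖ / ‖z‖) ‖z‖) :
    HasFDerivAt (fun z : E => b ‖z‖ • z) (radialDeriv b c z) z := by
  have h := (hb.comp_hasFDerivAt z (hasFDerivAt_norm hz)).smul (hasFDerivAt_id z)
  refine h.congr_fderiv ?_
  ext w
  have : ‖z‖ ≠ 0 := norm_ne_zero_iff.2 hz
  rw [radialDeriv_of_ne hz, radProj_apply]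
  simp [smul_smul]
  congr 1
  field_simp

namespace RadialProfile

variable {b c : ℝ → ℝ}

lemma exists_bound (h : RadialProfile b c) : ∃ C, 0 ≤ C ∧ ∀ z : E,
    ‖b ‖z‖ • z‖ ≤ C * ‖z‖ ∧ ‖b ‖z‖ • z‖ ≤ C * ‖z‖ ^ 2 ∧
      ‖radialDeriv b c z‖ ≤ C ∧ ‖radialDeriv b c z‖ ≤ C * ‖z‖ := by
  obtain ⟨C, hC⟩ := h.bound
  have hC0 : 0 ≤ C := (abs_nonneg _).trans (hC 1 one_pos).1
  refine ⟨2 * C, by positivity, fun z => ?_⟩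
  rcases eq_or_ne z 0 with rfl | hz
  · simp [radialDeriv, hC0]
  have hz' : 0 < ‖z‖ := norm_pos_iff.2 hz
  obtain ⟨h1, h2, h3, h4⟩ := hC _ hz'
  have hD : ‖radialDeriv b c z‖ ≤ |b ‖z‖| + |c ‖z‖| := by
    rw [radialDeriv, if_neg hz]
    refine (norm_add_le _ _).trans ?_
    rw [norm_smul, norm_smul, Real.norm_eq_abs, Real.norm_eq_abs]
    have e1 : |b ‖z‖| * ‖ContinuousLinearMap.id ℝ E‖ ≤ |b ‖z‖| * 1 := by
      gcongr
      exact ContinuousLinearMap.norm_id_le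
    have e2 : |c ‖z‖| * ‖radProj z‖ ≤ |c ‖z‖| * 1 := by
      gcongr
      exact norm_radProj_le z
    linarith
  rw [norm_smul, Real.norm_eq_abs]
  refine ⟨?_, ?_, by linarith, by linarith⟩
  · nlinarith
  · nlinarith [mul_le_mul_of_nonneg_right h2 hz'.le, mul_nonneg hC0 (sq_nonneg ‖z‖)]

/-- Away from the origin this is the product rule; at the origin the map is `O(|z|²)`, so its
derivative is zero. -/
lemma hasFDerivAt (h : RadialProfile b c) (z : E) :
    HasFDerivAt (fun z : E => b ‖z‖ • z) (radialDeriv b c z) z := by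
  rcases eq_or_ne z 0 with rfl | hz
  · obtain ⟨C, -, hC⟩ := h.exists_bound (E := E)
    have hO : (fun z : E => b ‖z‖ • z) =O[𝓝 0] fun z => ‖z - 0‖ ^ 2 :=
      Asymptotics.IsBigO.of_bound C (.of_forall fun z => by simpa using (hC z).2.1)
    simpa [radialDeriv] using hO.hasFDerivAt one_lt_two
  · exact hasFDerivAt_radial_of_ne hz (h.hasDerivAt _ (norm_pos_iff.2 hz))

lemma continuous_radialDeriv (h : RadialProfile b c) :
    Continuous (radialDeriv b c : E → E →L[ℝ] E) := by
  refine continuous_iff_continuousAt.2 fun z => ?_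
  rcases eq_or_ne z 0 with rfl | hz
  · obtain ⟨C, -, hC⟩ := h.exists_bound (E := E)
    have h0 : radialDeriv b c (0 : E) = 0 := by simp [radialDeriv]
    rw [ContinuousAt, h0]
    refine squeeze_zero_norm (fun z => (hC z).2.2.2) ?_
    have : Continuous fun z : E => C * ‖z‖ := by fun_prop
    simpa using this.tendsto 0
  · have hz' : 0 < ‖z‖ := norm_pos_iff.2 hz
    have hev : (radialDeriv b c : E → E →L[ℝ] E) =ᶠ[𝓝 z] fun z =>
        b ‖z‖ • ContinuousLinearMap.id ℝ E + c ‖z‖ • radProj z := by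
      filter_upwards [isOpen_ne.mem_nhds hz] with w hw
      simp only [radialDeriv, if_neg (show w ≠ 0 from hw)]
    refine ContinuousAt.congr ?_ hev.symm
    have hb : ContinuousAt (fun z : E => b ‖z‖) z :=
      (h.hasDerivAt _ hz').continuousAt.comp (f := fun z : E => ‖z‖) continuous_norm.continuousAt
    have hc : ContinuousAt (fun z : E => c ‖z‖) z :=
      (h.continuousOn.continuousAt (Ioi_mem_nhds hz')).comp (f := fun z : E => ‖z‖)
        continuous_norm.continuousAt
    exact (hb.smul continuousAt_const).add (hc.smul (continuousAt_radProj hz))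

lemma contDiff (h : RadialProfile b c) : ContDiff ℝ 1 (fun z : E => b ‖z‖ • z) :=
  contDiff_one_iff_hasFDerivAt.2 ⟨_, h.continuous_radialDeriv, h.hasFDerivAt⟩

/-- Profiles supported in a compact subset of `(0, ∞)`. -/
lemma of_eq_zero {α β : ℝ} (hα : 0 < α) (hb : ∀ t, 0 < t → HasDerivAt b (c t / t) t)
    (hc : ContinuousOn c (Ioi 0))
    (h0 : ∀ t, 0 < t → t ∉ Icc α β → b t = 0 ∧ c t = 0) : RadialProfile b c := by
  refine ⟨hb, hc, ?_⟩
  have hsub : Icc α β ⊆ Ioi 0 := fun t ht => hα.trans_le ht.1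
  obtain ⟨M, hM⟩ := isCompact_Icc.exists_bound_of_continuousOn
    (fun t ht => (hb t (hsub ht)).continuousAt.continuousWithinAt : ContinuousOn b (Icc α β))
  obtain ⟨M', hM'⟩ := isCompact_Icc.exists_bound_of_continuousOn (hc.mono hsub)
  set K := max (max M M') 0
  have hK : 0 ≤ K := le_max_right _ _
  -- On the support `t ≥ α`, so a bound by `K` is also one by `(K / α) t`.
  refine ⟨K + K / α, fun t ht => ?_⟩
  have hKα : 0 ≤ K / α := by positivity
  have hK2 : 0 ≤ (K + K / α) * t := by positivity
  by_cases hmem : t ∈ Icc α β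
  · have h1 : |b t| ≤ K := (hM t hmem).trans ((le_max_left _ _).trans (le_max_left _ _))
    have h2 : |c t| ≤ K := (hM' t hmem).trans ((le_max_right _ _).trans (le_max_left _ _))
    have h3 : K ≤ (K + K / α) * t := by
      have : K = K / α * α := by field_simp
      have h4 : K / α * α ≤ K / α * t := by gcongr; exact hmem.1
      nlinarith
    exact ⟨by linarith, by linarith, by linarith, by linarith⟩
  · obtain ⟨h1, h2⟩ := h0 t ht hmem
    rw [h1, h2, abs_zero]
    exact ⟨by linarith, hK2, by linarith, hK2⟩

end RadialProfile

end Radial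

/-- Every nonlinear operation on `H¹₀` below (damping, cutoffs, and compositions with `φ` or `Θ`)
goes through this form of the chain rule. -/
lemma HasH10Grad.radial (hΩ : IsOpen Ω) {u : Pt N → CVec m} {g : Fin N → Pt N → CVec m}
    (h : HasH10Grad Ω u g) {b c : ℝ → ℝ} (hb : RadialProfile b c) :
    HasH10Grad Ω (fun x => b ‖u x‖ • u x) (fun k x => radialDeriv b c (u x) (g k x)) := by
  obtain ⟨C, -, hC⟩ := hb.exists_bound (E := CVec m)
  have hf : ∀ z : CVec m, fderiv ℝ (fun z : CVec m => b ‖z‖ • z) z = radialDeriv b c z :=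
    fun z => (hb.hasFDerivAt z).fderiv
  have := h.comp hΩ hb.contDiff (by simp) (M := C) (fun z => by rw [hf]; exact (hC z).2.2.1)
  simpa only [hf] using this

/-! ### Damping factors. -/

section Damp

/-- A factor close to `1` that vanishes to order `q` at the origin and decays at infinity. -/
noncomputable def damp (q : ℕ) (ε t : ℝ) : ℝ := (t / (t + ε)) ^ q / (1 + ε * t)

/-- The logarithmic derivative `t b'(t) / b(t)` of `b = damp q ε`. -/
noncomputable def dampLog (q : ℕ) (ε t : ℝ) : ℝ := q * (ε / (t + ε)) - ε * t / (1 + ε * t)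

variable {q : ℕ} {ε t : ℝ}

lemma damp_pos (hε : 0 < ε) (ht : 0 < t) : 0 < damp q ε t := by
  unfold damp
  positivity

lemma div_add_le_one (hε : 0 < ε) (ht : 0 < t) : t / (t + ε) ≤ 1 :=
  (div_le_one (by positivity)).2 (by linarith)

lemma damp_le_one (hε : 0 < ε) (ht : 0 < t) : damp q ε t ≤ 1 := by
  have h1 := div_add_le_one hε ht
  have h2 : (t / (t + ε)) ^ q ≤ 1 := pow_le_one₀ (by positivity) h1
  unfold damp
  rw [div_le_one (by positivity)]
  nlinarith [mul_pos hε ht]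

/-- For fixed `ε` the damped modulus stays bounded, so the behaviour of `Θ` at infinity becomes
irrelevant. -/
lemma mul_damp_le (hε : 0 < ε) (ht : 0 < t) : t * damp q ε t ≤ ε⁻¹ := by
  have h2 : (t / (t + ε)) ^ q ≤ 1 := pow_le_one₀ (by positivity) (div_add_le_one hε ht)
  unfold damp
  rw [mul_div_assoc', div_le_iff₀ (by positivity)]
  have : ε⁻¹ * (1 + ε * t) = ε⁻¹ + t := by field_simp
  rw [this]
  have : 0 < ε⁻¹ := by positivity
  nlinarith

lemma damp_le_pow (hε : 0 < ε) (ht : 0 < t) : damp q ε t ≤ (t / ε) ^ q := by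
  have h2 : (t / (t + ε)) ^ q ≤ (t / ε) ^ q := by
    gcongr
    linarith
  unfold damp
  refine (div_le_self (by positivity) ?_).trans h2
  nlinarith [mul_pos hε ht]

/-- The bound does not depend on `ε`; this is what supplies the dominating functions as `ε → 0`. -/
lemma abs_dampLog_le (hε : 0 < ε) (ht : 0 < t) : |dampLog q ε t| ≤ q + 1 := by
  have h1 : ε / (t + ε) ≤ 1 := (div_le_one (by positivity)).2 (by linarith)
  have h2 : 0 ≤ ε / (t + ε) := by positivity
  have h3 : ε * t / (1 + ε * t) ≤ 1 := (div_le_one (by positivity)).2 (by linarith)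
  have h4 : 0 ≤ ε * t / (1 + ε * t) := by positivity
  have hq : (0 : ℝ) ≤ q := q.cast_nonneg
  unfold dampLog
  rw [abs_le]
  constructor <;> nlinarith [mul_nonneg hq h2, mul_le_mul_of_nonneg_left h1 hq]

lemma hasDerivAt_damp (hε : 0 < ε) (ht : 0 < t) :
    HasDerivAt (damp q ε) (damp q ε t * dampLog q ε t / t) t := by
  have hte : t + ε ≠ 0 := by positivity
  have h1e : 1 + ε * t ≠ 0 := by positivity
  have h1 := (hasDerivAt_id t).div ((hasDerivAt_id t).add_const ε) hte
  have h2 := h1.pow q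
  have h3 := ((hasDerivAt_id t).const_mul ε).const_add 1
  have h4 := h2.div h3 h1e
  refine HasDerivAt.congr_deriv (f := damp q ε) h4 ?_
  rcases q with _ | q
  · simp [damp, dampLog]
    field_simp
  · simp only [damp, dampLog, id, Pi.div_apply, Pi.pow_apply, Nat.add_sub_cancel]
    simp only [pow_succ _ q]
    generalize (t / (t + ε)) ^ q = X
    push_cast
    field_simp
    ring

lemma continuousOn_damp (hε : 0 < ε) : ContinuousOn (damp q ε) (Ioi 0) := fun _ ht =>
  (hasDerivAt_damp hε ht).continuousAt.continuousWithinAt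

lemma continuousOn_dampLog (hε : 0 < ε) : ContinuousOn (dampLog q ε) (Ioi 0) := by
  unfold dampLog
  refine ContinuousOn.sub (ContinuousOn.mul continuousOn_const (ContinuousOn.div continuousOn_const
    (by fun_prop) fun t ht => ?_)) (ContinuousOn.div (by fun_prop) (by fun_prop) fun t ht => ?_)
  all_goals
    have ht' : 0 < t := ht
    positivity

lemma radialProfile_damp (hq : q ≠ 0) (hε : 0 < ε) :
    RadialProfile (damp q ε) (fun t => damp q ε t * dampLog q ε t) := by
  refine ⟨fun t ht => hasDerivAt_damp hε ht, (continuousOn_damp hε).mul (continuousOn_dampLog hε),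
    (q + 1) * (1 + ε⁻¹), fun t ht => ?_⟩
  have hp := damp_pos (q := q) hε ht
  have h1 := damp_le_one (q := q) hε ht
  have h2 : damp q ε t ≤ ε⁻¹ * t := by
    have ha : t / (t + ε) ≤ t / ε := by gcongr; linarith
    have hb : (t / (t + ε)) ^ q ≤ t / (t + ε) :=
      pow_le_of_le_one (by positivity) (div_add_le_one hε ht) hq
    have hc : damp q ε t ≤ (t / (t + ε)) ^ q :=
      div_le_self (by positivity) (by nlinarith [mul_pos hε ht])
    exact (hc.trans (hb.trans ha)).trans (le_of_eq (by ring))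
  have h3 := abs_dampLog_le (q := q) hε ht
  have hq0 : (0 : ℝ) ≤ q := q.cast_nonneg
  have hi : 0 < ε⁻¹ := by positivity
  have hC : 1 ≤ 1 + ε⁻¹ := by linarith
  have e1 : damp q ε t ≤ 1 + ε⁻¹ := by linarith
  have e2 : damp q ε t ≤ (1 + ε⁻¹) * t := by nlinarith
  rw [abs_mul, abs_of_pos hp]
  have aux : ∀ X : ℝ, 0 ≤ X → X ≤ (q + 1) * X := fun X hX => by nlinarith [mul_nonneg hq0 hX]
  refine ⟨e1.trans (aux _ (by positivity)), e2.trans ?_, ?_, ?_⟩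
  · rw [mul_assoc]
    exact aux _ (by positivity)
  · rw [mul_comm]
    gcongr
  · rw [mul_comm, mul_assoc]
    gcongr

lemma tendsto_damp {e : ℕ → ℝ} (he : Tendsto e atTop (𝓝 0)) (ht : 0 < t) :
    Tendsto (fun n => damp q (e n) t) atTop (𝓝 1) := by
  have h1 : Tendsto (fun n => t / (t + e n)) atTop (𝓝 (t / (t + 0))) :=
    tendsto_const_nhds.div (tendsto_const_nhds.add he) (by simpa using ht.ne')
  have h2 : Tendsto (fun n => 1 + e n * t) atTop (𝓝 (1 + 0 * t)) :=
    tendsto_const_nhds.add (he.mul_const t)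
  have h3 := (h1.pow q).div h2 (by simp)
  simp only [add_zero, zero_mul, div_self ht.ne', one_pow, div_one] at h3
  exact h3

lemma tendsto_dampLog {e : ℕ → ℝ} (he : Tendsto e atTop (𝓝 0)) (ht : 0 < t) :
    Tendsto (fun n => dampLog q (e n) t) atTop (𝓝 0) := by
  have h1 : Tendsto (fun n => e n / (t + e n)) atTop (𝓝 (0 / (t + 0))) :=
    he.div (tendsto_const_nhds.add he) (by simpa using ht.ne')
  have h2 : Tendsto (fun n => e n * t / (1 + e n * t)) atTop (𝓝 (0 * t / (1 + 0 * t))) :=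
    (he.mul_const t).div (tendsto_const_nhds.add (he.mul_const t)) (by simp)
  have h3 := (h1.const_mul (q : ℝ)).sub h2
  simp only [zero_div, zero_mul, mul_zero, sub_zero] at h3
  exact h3

lemma tendsto_radialDeriv_damp {E : Type*} [NormedAddCommGroup E] [InnerProductSpace ℝ E]
    {e : ℕ → ℝ} (he : Tendsto e atTop (𝓝 0)) {z : E} (hz : z ≠ 0) (h : E) :
    Tendsto (fun n => radialDeriv (damp q (e n)) (fun t => damp q (e n) t * dampLog q (e n) t) z h)
      atTop (𝓝 h) := by
  have hz' : 0 < ‖z‖ := norm_pos_iff.2 hz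
  simp only [radialDeriv_of_ne hz]
  have h1 := tendsto_damp (q := q) he hz'
  have h2 := h1.mul (tendsto_dampLog (q := q) he hz')
  simpa using (h1.smul_const h).add (h2.smul_const (radProj z h))

lemma norm_radialDeriv_damp_le {E : Type*} [NormedAddCommGroup E] [InnerProductSpace ℝ E]
    (hε : 0 < ε) (z h : E) :
    ‖radialDeriv (damp q ε) (fun t => damp q ε t * dampLog q ε t) z h‖ ≤ (q + 2) * ‖h‖ := by
  rcases eq_or_ne z 0 with rfl | hz
  · simp only [radialDeriv, if_true, _root_.zero_apply, norm_zero]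
    positivity
  have hz' : 0 < ‖z‖ := norm_pos_iff.2 hz
  have h1 := damp_le_one (q := q) hε hz'
  have hp := damp_pos (q := q) hε hz'
  rw [radialDeriv_of_ne hz]
  refine (norm_add_le _ _).trans ?_
  rw [norm_smul, norm_smul, norm_mul, Real.norm_eq_abs, Real.norm_eq_abs, abs_of_pos hp]
  calc damp q ε ‖z‖ * ‖h‖ + damp q ε ‖z‖ * |dampLog q ε ‖z‖| * ‖radProj z h‖
      ≤ 1 * ‖h‖ + 1 * (q + 1) * ‖h‖ := by
        gcongr
        · exact abs_dampLog_le hε hz'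
        · exact norm_radProj_apply_le z h
    _ = (q + 2) * ‖h‖ := by ring

end Damp

/-- The gradient of an element of `H¹₀` vanishes almost everywhere where the function does. -/
lemma HasH10Grad.ae_eq_zero (hΩ : IsOpen Ω) {u : Pt N → CVec m} {g : Fin N → Pt N → CVec m}
    (h : HasH10Grad Ω u g) : ∀ᵐ x ∂(volume.restrict Ω), u x = 0 → ∀ k, g k x = 0 := by
  classical
  set e : ℕ → ℝ := fun n => 1 / ((n : ℝ) + 1)
  have he : Tendsto e atTop (𝓝 0) := tendsto_one_div_add_atTop_nhds_zero_nat
  have hepos : ∀ n, 0 < e n := fun n => by positivity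
  have h1 := fun n => h.radial hΩ (radialProfile_damp one_ne_zero (hepos n))
  -- The damped functions have gradient zero wherever `u = 0`, so in the limit `u` also has the
  -- gradient `g` truncated to `u ≠ 0`; uniqueness then gives the claim.
  have hlim : HasH10Grad Ω u (fun k x => if u x = 0 then 0 else g k x) := by
    refine HasH10Grad.of_dominated (B := fun x => ‖u x‖)
      (B' := fun k x => ((1 : ℕ) + 2) * ‖g k x‖) h1 h.memLp.norm
      (fun k => (h.memLp_grad k).norm.const_mul _) (fun n => .of_forall fun x => ?_)
      (fun n k => .of_forall fun x => norm_radialDeriv_damp_le (hepos n) _ _)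
      (.of_forall fun x => ?_) (fun k => .of_forall fun x => ?_)
    · rcases eq_or_ne (u x) 0 with hx | hx
      · simp [hx]
      have hx' := norm_pos_iff.2 hx
      rw [norm_smul, Real.norm_eq_abs, abs_of_pos (damp_pos (hepos n) hx')]
      exact mul_le_of_le_one_left hx'.le (damp_le_one (hepos n) hx')
    · rcases eq_or_ne (u x) 0 with hx | hx
      · simp [hx]
      simpa using (tendsto_damp he (norm_pos_iff.2 hx)).smul_const (u x)
    · by_cases hx : u x = 0
      · simp [hx, radialDeriv]
      · simp only [if_neg hx]
        exact tendsto_radialDeriv_damp he hx _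
  filter_upwards [ae_all_iff.2 fun k => h.ae_unique hΩ hlim k] with x hx hx0 k
  rw [hx k, if_pos hx0]

/-! ### Logarithmic cutoffs. -/

section LogCutoff

/-- A smooth bump function on the line, equal to `1` near `[-1, 1]`. -/
def lineBump : ContDiffBump (0 : ℝ) := ⟨1, 2, one_pos, one_lt_two⟩

/-- Cutoff functions on `(0, ∞)` on a logarithmic scale. -/
noncomputable def logCut (n : ℕ) (s : ℝ) : ℝ := lineBump (Real.log s / (n + 1))

/-- The function `s χ'(s)` for `χ = logCut n`. -/
noncomputable def logCutDeriv (n : ℕ) (s : ℝ) : ℝ := deriv lineBump (Real.log s / (n + 1)) / (n + 1)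

lemma hasDerivAt_logCut (n : ℕ) {s : ℝ} (hs : 0 < s) :
    HasDerivAt (logCut n) (logCutDeriv n s / s) s := by
  have h1 : HasDerivAt (fun s : ℝ => Real.log s / ((n : ℝ) + 1)) (s⁻¹ / (n + 1)) s :=
    (Real.hasDerivAt_log hs.ne').div_const _
  have h2 : HasDerivAt lineBump (deriv lineBump (Real.log s / (n + 1))) (Real.log s / (n + 1)) :=
    ((lineBump.contDiff (n := 1)).differentiable one_ne_zero _).hasDerivAt
  refine (h2.comp s h1).congr_deriv ?_
  rw [logCutDeriv]
  field_simp

lemma logCut_mem (n : ℕ) (s : ℝ) : logCut n s ∈ Icc (0 : ℝ) 1 :=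
  ⟨lineBump.nonneg, lineBump.le_one⟩

lemma continuousOn_logCutDeriv (n : ℕ) : ContinuousOn (logCutDeriv n) (Ioi 0) := by
  have h : Continuous (deriv lineBump) := (lineBump.contDiff (n := 1)).continuous_deriv le_rfl
  refine (h.comp_continuousOn ?_).div_const _
  exact (Real.continuousOn_log.mono fun x hx => (ne_of_gt hx)).div_const _

/-- The logarithmic scale makes `s χ'(s)` bounded uniformly in `n`, so the cutoff costs only a
constant in gradient estimates. -/
lemma exists_logCutDeriv_bound : ∃ D, 0 ≤ D ∧ ∀ n s, |logCutDeriv n s| ≤ D := by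
  have h : Continuous (deriv lineBump) := (lineBump.contDiff (n := 1)).continuous_deriv le_rfl
  obtain ⟨D, hD⟩ := lineBump.hasCompactSupport.deriv.exists_bound_of_continuous h
  have hD0 : 0 ≤ D := (norm_nonneg _).trans (hD 0)
  refine ⟨D, hD0, fun n s => ?_⟩
  rw [logCutDeriv, abs_div, abs_of_nonneg (by positivity : (0 : ℝ) ≤ n + 1)]
  refine (div_le_self (abs_nonneg _) ?_).trans (hD _)
  linarith [n.cast_nonneg (α := ℝ)]

lemma eventually_logCut (s : ℝ) : ∀ᶠ n in atTop, logCut n s = 1 ∧ logCutDeriv n s = 0 := by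
  filter_upwards [(tendsto_natCast_atTop_atTop (R := ℝ)).eventually_gt_atTop |Real.log s|] with n hn
  have hpos : (0 : ℝ) < n + 1 := by positivity
  have hlt : Real.log s / (n + 1) ∈ Metric.ball (0 : ℝ) 1 := by
    rw [mem_ball_zero_iff, Real.norm_eq_abs, abs_div, abs_of_pos hpos, div_lt_one hpos]
    linarith
  refine ⟨lineBump.one_of_mem_closedBall (Metric.ball_subset_closedBall hlt), ?_⟩
  have hev : (lineBump : ℝ → ℝ) =ᶠ[𝓝 (Real.log s / (n + 1))] fun _ => 1 := by
    filter_upwards [Metric.isOpen_ball.mem_nhds hlt] with y hy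
    exact lineBump.one_of_mem_closedBall (Metric.ball_subset_closedBall hy)
  rw [logCutDeriv, hev.deriv_eq]
  simp

lemma logCut_eq_zero (n : ℕ) {s : ℝ} (hs : 0 < s)
    (h : s ∉ Icc (Real.exp (-(2 * (n + 1)))) (Real.exp (2 * (n + 1)))) :
    logCut n s = 0 ∧ logCutDeriv n s = 0 := by
  have hpos : (0 : ℝ) < n + 1 := by positivity
  have hgt : Real.log s / (n + 1) ∉ tsupport lineBump := by
    rw [lineBump.tsupport_eq, mem_closedBall_zero_iff, Real.norm_eq_abs, abs_div, abs_of_pos hpos,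
      div_le_iff₀ hpos]
    intro hle
    have hle' : |Real.log s| ≤ 2 * (n + 1) := hle
    rw [abs_le, Real.le_log_iff_exp_le hs, Real.log_le_iff_le_exp hs] at hle'
    exact h hle'
  refine ⟨image_eq_zero_of_notMem_tsupport (f := lineBump) hgt, ?_⟩
  rw [logCutDeriv, (HasDerivAt.of_notMem_tsupport (f := lineBump) hgt).deriv, zero_div]

lemma radialProfile_logCut (n : ℕ) : RadialProfile (logCut n) (logCutDeriv n) :=
  .of_eq_zero (Real.exp_pos _) (fun _ ht => hasDerivAt_logCut n ht) (continuousOn_logCutDeriv n)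
    (fun _ ht h => logCut_eq_zero n ht h)

end LogCutoff

/-! ### Calculus and estimates for `φ`, `ζ`, `Θ` and `Λ`. -/

/-- The logarithmic derivative `s φ'(s) / φ(s)`. -/
noncomputable def phiLog (φ : ℝ → ℝ) (s : ℝ) : ℝ := s * deriv φ s / φ s

namespace Admissible

lemma differentiableAt (hφ : Admissible φ) {s : ℝ} (hs : 0 < s) : DifferentiableAt ℝ φ s :=
  (hφ.contDiffOn.differentiableOn one_ne_zero).differentiableAt (Ioi_mem_nhds hs)

lemma hasDerivAt (hφ : Admissible φ) {s : ℝ} (hs : 0 < s) :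
    HasDerivAt φ (φ s * phiLog φ s / s) s := by
  refine (hφ.differentiableAt hs).hasDerivAt.congr_deriv ?_
  have := (hφ.pos s hs).ne'
  rw [phiLog]
  field_simp

lemma continuousOn (hφ : Admissible φ) : ContinuousOn φ (Ioi 0) := hφ.contDiffOn.continuousOn

lemma continuousOn_phiLog (hφ : Admissible φ) : ContinuousOn (phiLog φ) (Ioi 0) :=
  (continuousOn_id.mul (hφ.contDiffOn.continuousOn_deriv_of_isOpen isOpen_Ioi le_rfl)).div
    hφ.continuousOn fun s hs => (hφ.pos s hs).ne'

lemma hasDerivAt_mul (hφ : Admissible φ) {s : ℝ} (hs : 0 < s) :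
    HasDerivAt (fun σ => σ * φ σ) (φ s * (1 + phiLog φ s)) s := by
  refine ((hasDerivAt_id s).mul (hφ.hasDerivAt hs)).congr_deriv ?_
  simp only [id]
  field_simp

/-- Since `(s φ)' = φ (1 + y)` with `y = s φ' / φ`, this is assumption (ii) in logarithmic form. -/
lemma neg_one_lt_phiLog (hφ : Admissible φ) {s : ℝ} (hs : 0 < s) : -1 < phiLog φ s := by
  have h := hφ.deriv_pos s hs
  rw [(hφ.hasDerivAt_mul hs).deriv] at h
  linarith [(pos_iff_pos_of_mul_pos h).1 (hφ.pos s hs)]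

lemma strictMonoOn_mul (hφ : Admissible φ) : StrictMonoOn (fun σ => σ * φ σ) (Ioi 0) :=
  strictMonoOn_of_deriv_pos (convex_Ioi 0) (continuousOn_id.mul hφ.continuousOn) fun s hs => by
    rw [interior_Ioi] at hs
    exact hφ.deriv_pos s hs

lemma hasDerivAt_sqrt (hφ : Admissible φ) {s : ℝ} (hs : 0 < s) :
    HasDerivAt (fun σ => √(φ σ)) (√(φ s) * (phiLog φ s / 2) / s) s := by
  have hp := hφ.pos s hs
  refine ((hφ.hasDerivAt hs).sqrt hp.ne').congr_deriv ?_
  have h1 : √(φ s) ≠ 0 := (Real.sqrt_pos.2 hp).ne'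
  have h2 : φ s = √(φ s) * √(φ s) := (Real.mul_self_sqrt hp.le).symm
  field_simp
  rw [sq, ← h2]
  ring

lemma hasDerivAt_mul_sqrt (hφ : Admissible φ) {s : ℝ} (hs : 0 < s) :
    HasDerivAt (fun σ => σ * √(φ σ)) (√(φ s) * (1 + phiLog φ s / 2)) s := by
  refine ((hasDerivAt_id s).mul (hφ.hasDerivAt_sqrt hs)).congr_deriv ?_
  simp only [id]
  field_simp

lemma strictMonoOn_mul_sqrt (hφ : Admissible φ) : StrictMonoOn (fun σ => σ * √(φ σ)) (Ioi 0) :=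
  strictMonoOn_of_deriv_pos (convex_Ioi 0) (continuousOn_id.mul hφ.continuousOn.sqrt)
    fun s hs => by
      rw [interior_Ioi] at hs
      rw [(hφ.hasDerivAt_mul_sqrt hs).deriv]
      have := hφ.neg_one_lt_phiLog hs
      exact mul_pos (Real.sqrt_pos.2 (hφ.pos s hs)) (by linarith)

lemma mul_sqrt_sq (hφ : Admissible φ) {s : ℝ} (hs : 0 < s) :
    (s * √(φ s)) ^ 2 = s * (s * φ s) := by
  rw [mul_pow, Real.sq_sqrt (hφ.pos s hs).le]
  ring

lemma exists_mul_sqrt_eq (hφ : Admissible φ) {t : ℝ} (ht : 0 < t) :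
    ∃ s ∈ Ioi (0 : ℝ), s * √(φ s) = t := by
  have h1 : 0 < φ 1 := hφ.pos 1 one_pos
  -- As `(s √φ(s))² = s (s φ(s))` and `s φ(s)` is increasing, comparison with `s = 1` shows that the
  -- values of `s √φ(s)` at `a` and `b` enclose `t`.
  set a := min 1 (t ^ 2 / φ 1)
  set b := max 1 (t ^ 2 / φ 1)
  have ha : 0 < a := lt_min one_pos (by positivity)
  have hb : 0 < b := one_pos.trans_le (le_max_left _ _)
  have hab : a ≤ b := (min_le_left _ _).trans (le_max_left _ _)
  have hga : a * √(φ a) ≤ t := by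
    refine le_of_sq_le_sq ?_ ht.le
    rw [hφ.mul_sqrt_sq ha]
    have e1 : a * φ a ≤ 1 * φ 1 :=
      hφ.strictMonoOn_mul.monotoneOn (mem_Ioi.2 ha) (mem_Ioi.2 one_pos) (min_le_left _ _)
    have e2 : a ≤ t ^ 2 / φ 1 := min_le_right _ _
    calc a * (a * φ a) ≤ t ^ 2 / φ 1 * (1 * φ 1) := by
          have : 0 < a * φ a := mul_pos ha (hφ.pos a ha)
          gcongr
      _ = t ^ 2 := by field_simp
  have hgb : t ≤ b * √(φ b) := by
    refine le_of_sq_le_sq ?_ (by positivity)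
    rw [hφ.mul_sqrt_sq hb]
    have e1 : 1 * φ 1 ≤ b * φ b :=
      hφ.strictMonoOn_mul.monotoneOn (mem_Ioi.2 one_pos) (mem_Ioi.2 hb) (le_max_left _ _)
    have e2 : t ^ 2 / φ 1 ≤ b := le_max_right _ _
    calc t ^ 2 = t ^ 2 / φ 1 * (1 * φ 1) := by field_simp
      _ ≤ b * (b * φ b) := by gcongr
  obtain ⟨s, hs, hst⟩ := intermediate_value_Icc hab
    ((continuousOn_id.mul hφ.continuousOn.sqrt).mono fun x hx => ha.trans_le hx.1) ⟨hga, hgb⟩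
  exact ⟨s, ha.trans_le hs.1, hst⟩

lemma zeta_pos (hφ : Admissible φ) {t : ℝ} (ht : 0 < t) : 0 < zeta φ t :=
  Function.invFunOn_mem (hφ.exists_mul_sqrt_eq ht)

lemma zeta_mul_sqrt (hφ : Admissible φ) {t : ℝ} (ht : 0 < t) :
    zeta φ t * √(φ (zeta φ t)) = t :=
  Function.invFunOn_eq (hφ.exists_mul_sqrt_eq ht)

lemma mul_sqrt_pos (hφ : Admissible φ) {s : ℝ} (hs : 0 < s) : 0 < s * √(φ s) :=
  mul_pos hs (Real.sqrt_pos.2 (hφ.pos s hs))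

lemma zeta_apply (hφ : Admissible φ) {s : ℝ} (hs : 0 < s) : zeta φ (s * √(φ s)) = s :=
  hφ.strictMonoOn_mul_sqrt.injOn (mem_Ioi.2 (hφ.zeta_pos (hφ.mul_sqrt_pos hs))) (mem_Ioi.2 hs)
    (hφ.zeta_mul_sqrt (hφ.mul_sqrt_pos hs))

lemma monotoneOn_zeta (hφ : Admissible φ) : MonotoneOn (zeta φ) (Ioi 0) := fun t ht t' ht' h => by
  rw [← hφ.strictMonoOn_mul_sqrt.le_iff_le (hφ.zeta_pos ht) (hφ.zeta_pos ht')]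
  simpa only [hφ.zeta_mul_sqrt ht, hφ.zeta_mul_sqrt ht'] using h

/-- A monotone function whose image contains a neighbourhood of its value has no jump there. -/
lemma continuousAt_zeta (hφ : Admissible φ) {t : ℝ} (ht : 0 < t) : ContinuousAt (zeta φ) t := by
  refine continuousAt_of_monotoneOn_of_image_mem_nhds hφ.monotoneOn_zeta (Ioi_mem_nhds ht) ?_
  refine mem_of_superset (Ioi_mem_nhds (hφ.zeta_pos ht)) fun s hs => ?_
  exact ⟨s * √(φ s), hφ.mul_sqrt_pos hs, hφ.zeta_apply hs⟩

lemma hasDerivAt_zeta (hφ : Admissible φ) {t : ℝ} (ht : 0 < t) :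
    HasDerivAt (zeta φ) (√(φ (zeta φ t)) * (1 + phiLog φ (zeta φ t) / 2))⁻¹ t := by
  have hz := hφ.zeta_pos ht
  have := hφ.neg_one_lt_phiLog hz
  refine (hφ.hasDerivAt_mul_sqrt hz).of_local_left_inverse (hφ.continuousAt_zeta ht)
    (mul_pos (Real.sqrt_pos.2 (hφ.pos _ hz)) (by linarith)).ne' ?_
  filter_upwards [Ioi_mem_nhds ht] with t' ht'
  exact hφ.zeta_mul_sqrt ht'

lemma hasDerivAt_Theta_aux (hφ : Admissible φ) {t : ℝ} (ht : 0 < t) :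
    HasDerivAt (Theta φ)
      (Theta φ t * (-phiLog φ (zeta φ t) / (phiLog φ (zeta φ t) + 2)) / t) t := by
  have hz := hφ.zeta_pos ht
  have hy := hφ.neg_one_lt_phiLog hz
  refine HasDerivAt.congr_deriv (f := Theta φ)
    ((hφ.hasDerivAt_zeta ht).div (hasDerivAt_id t) ht.ne') ?_
  have h1 := hφ.zeta_mul_sqrt ht
  have h2 : √(φ (zeta φ t)) = t / zeta φ t := by
    field_simp
    linarith
  rw [Theta, h2]
  generalize phiLog φ (zeta φ t) = y at hy
  have h3 : y + 2 ≠ 0 := by linarith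
  have h4 : 1 + y / 2 ≠ 0 := by linarith
  have h5 : 2 + y ≠ 0 := by linarith
  field_simp
  ring

lemma Theta_pos (hφ : Admissible φ) {t : ℝ} (ht : 0 < t) : 0 < Theta φ t :=
  div_pos (hφ.zeta_pos ht) ht

lemma Lam_eq (hφ : Admissible φ) {t : ℝ} (ht : 0 < t) :
    Lam φ t = -phiLog φ (zeta φ t) / (phiLog φ (zeta φ t) + 2) := by
  have := (hφ.Theta_pos ht).ne'
  rw [Lam, (hφ.hasDerivAt_Theta_aux ht).deriv]
  field_simp

lemma hasDerivAt_Theta (hφ : Admissible φ) {t : ℝ} (ht : 0 < t) :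
    HasDerivAt (Theta φ) (Theta φ t * Lam φ t / t) t := by
  rw [hφ.Lam_eq ht]
  exact hφ.hasDerivAt_Theta_aux ht

lemma continuousOn_Lam (hφ : Admissible φ) : ContinuousOn (Lam φ) (Ioi 0) := by
  have hy : ContinuousOn (fun t => phiLog φ (zeta φ t)) (Ioi 0) :=
    hφ.continuousOn_phiLog.comp (fun t ht => (hφ.continuousAt_zeta ht).continuousWithinAt)
      fun t ht => hφ.zeta_pos ht
  refine ContinuousOn.congr (hy.neg.div (hy.add continuousOn_const) fun t ht => ?_)
    fun t ht => hφ.Lam_eq ht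
  have := hφ.neg_one_lt_phiLog (hφ.zeta_pos ht)
  simp only [Pi.add_apply, ne_eq]
  linarith

/-- With `Λ = -y / (y + 2)`, this is `|y| ≤ y + 2`, which follows from `y > -1`. -/
lemma abs_Lam_le (hφ : Admissible φ) {t : ℝ} (ht : 0 < t) : |Lam φ t| ≤ 1 := by
  have := hφ.neg_one_lt_phiLog (hφ.zeta_pos ht)
  rw [hφ.Lam_eq ht, abs_div, abs_neg, div_le_one (abs_pos.2 (by linarith)),
    abs_of_pos (by linarith : 0 < phiLog φ (zeta φ t) + 2), abs_le]
  constructor <;> linarith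

lemma sqrt_phi_zeta (hφ : Admissible φ) {t : ℝ} (ht : 0 < t) :
    √(φ (zeta φ t)) = (Theta φ t)⁻¹ := by
  have h1 := hφ.zeta_mul_sqrt ht
  have := hφ.zeta_pos ht
  rw [Theta, inv_div]
  field_simp
  linarith

lemma phi_zeta (hφ : Admissible φ) {t : ℝ} (ht : 0 < t) :
    φ (zeta φ t) = (Theta φ t)⁻¹ * (Theta φ t)⁻¹ := by
  rw [← hφ.sqrt_phi_zeta ht, Real.mul_self_sqrt (hφ.pos _ (hφ.zeta_pos ht)).le]

/-- Integrating the bounds on `(s φ)'` from `0` gives bounds of the same order `s ^ r` on `φ`; the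
integral converges because `r > -1`, and `s φ(s)` has boundary value `0` at the origin. -/
lemma exists_power_bounds (hφ : Admissible φ) : ∃ s₀ c C r s₁ : ℝ, 0 < s₀ ∧ 0 < c ∧ 0 < C ∧
    -1 < r ∧ (∀ s, 0 < s → s < s₀ → c * s ^ r ≤ φ s ∧ φ s ≤ C * s ^ r ∧
      c * s ^ r ≤ φ s * (1 + phiLog φ s) ∧ φ s * (1 + phiLog φ s) ≤ C * s ^ r) ∧
    s₀ < s₁ ∧ ((∀ s, s₁ ≤ s → 0 ≤ deriv φ s) ∨ (∀ s, s₁ ≤ s → deriv φ s ≤ 0)) := by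
  obtain ⟨s₀, hs₀, ⟨C₁, C₂, r, hC₁, hC₂, hr, hb, -⟩, s₁, hs₁, hsign⟩ := hφ.asymptotics
  have hr1 : 0 < r + 1 := by linarith
  have hpow : ∀ (K s : ℝ), 0 < s →
      HasDerivAt (fun s : ℝ => K / (r + 1) * s ^ (r + 1)) (K * s ^ r) s := by
    intro K s hs
    refine ((Real.hasDerivAt_rpow_const (p := r + 1) (Or.inl hs.ne')).const_mul _).congr_deriv ?_
    rw [add_sub_cancel_right]
    field_simp
  have hmono1 : MonotoneOn (fun s => s * φ s - C₁ / (r + 1) * s ^ (r + 1)) (Ioo 0 s₀) := by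
    have hd : ∀ s ∈ Ioo 0 s₀, HasDerivAt (fun s => s * φ s - C₁ / (r + 1) * s ^ (r + 1))
        (φ s * (1 + phiLog φ s) - C₁ * s ^ r) s := fun s hs =>
      (hφ.hasDerivAt_mul hs.1).sub (hpow C₁ s hs.1)
    refine monotoneOn_of_deriv_nonneg (convex_Ioo 0 s₀)
      (fun s hs => (hd s hs).continuousAt.continuousWithinAt) ?_ ?_ <;> rw [interior_Ioo]
    · exact fun s hs => (hd s hs).differentiableAt.differentiableWithinAt
    · intro s hs
      rw [(hd s hs).deriv]
      have := (hb s hs).1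
      rw [(hφ.hasDerivAt_mul hs.1).deriv] at this
      linarith
  have hmono2 : MonotoneOn (fun s => C₂ / (r + 1) * s ^ (r + 1) - s * φ s) (Ioo 0 s₀) := by
    have hd : ∀ s ∈ Ioo 0 s₀, HasDerivAt (fun s => C₂ / (r + 1) * s ^ (r + 1) - s * φ s)
        (C₂ * s ^ r - φ s * (1 + phiLog φ s)) s := fun s hs =>
      (hpow C₂ s hs.1).sub (hφ.hasDerivAt_mul hs.1)
    refine monotoneOn_of_deriv_nonneg (convex_Ioo 0 s₀)
      (fun s hs => (hd s hs).continuousAt.continuousWithinAt) ?_ ?_ <;> rw [interior_Ioo]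
    · exact fun s hs => (hd s hs).differentiableAt.differentiableWithinAt
    · intro s hs
      rw [(hd s hs).deriv]
      have := (hb s hs).2
      rw [(hφ.hasDerivAt_mul hs.1).deriv] at this
      linarith
  have hlow : ∀ s ∈ Ioo 0 s₀, C₁ / (r + 1) * s ^ (r + 1) ≤ s * φ s := by
    intro s hs
    have hlim : Tendsto (fun δ : ℝ => -(C₁ / (r + 1) * δ ^ (r + 1))) (𝓝[>] 0) (𝓝 0) := by
      have : Tendsto (fun δ : ℝ => δ ^ (r + 1)) (𝓝[>] 0) (𝓝 0) := by
        have := (Real.continuousAt_rpow_const 0 (r + 1) (Or.inr hr1.le)).tendsto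
        rw [Real.zero_rpow hr1.ne'] at this
        exact this.mono_left nhdsWithin_le_nhds
      simpa using (this.const_mul (C₁ / (r + 1))).neg
    have := le_of_tendsto hlim (b := s * φ s - C₁ / (r + 1) * s ^ (r + 1)) (by
      filter_upwards [Ioo_mem_nhdsGT hs.1] with δ hδ
      have h1 := hmono1 ⟨hδ.1, hδ.2.trans hs.2⟩ hs hδ.2.le
      have h2 := mul_pos hδ.1 (hφ.pos δ hδ.1)
      simp only at h1
      linarith)
    linarith
  have hup : ∀ s ∈ Ioo 0 s₀, s * φ s ≤ C₂ / (r + 1) * s ^ (r + 1) := by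
    intro s hs
    refine le_of_forall_pos_le_add fun ε hε => ?_
    have hpos : 0 < s * φ s := mul_pos hs.1 (hφ.pos s hs.1)
    -- The range condition supplies points where `s φ(s)` is arbitrarily small; the minimum with `s
    -- φ(s)` forces `δ ≤ s`.
    obtain ⟨δ, hδ, hδε⟩ : min ε (s * φ s) ∈ (fun s => s * φ s) '' Ioi 0 := by
      rw [hφ.range_eq]
      exact lt_min hε hpos
    have hδs : δ ≤ s := by
      rw [← hφ.strictMonoOn_mul.le_iff_le hδ (mem_Ioi.2 hs.1)]
      simp only at hδε ⊢
      rw [hδε]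
      exact min_le_right _ _
    have h1 := hmono2 ⟨hδ, hδs.trans_lt hs.2⟩ hs hδs
    have h2 : δ * φ δ ≤ ε := hδε.le.trans (min_le_left _ _)
    have h3 : 0 ≤ C₂ / (r + 1) * δ ^ (r + 1) :=
      mul_nonneg (by positivity) (Real.rpow_nonneg (le_of_lt hδ) _)
    simp only at h1
    linarith
  refine ⟨s₀, min C₁ (C₁ / (r + 1)), max C₂ (C₂ / (r + 1)), r, s₁, hs₀,
    lt_min hC₁ (by positivity), lt_max_of_lt_left hC₂, hr, fun s hs hss => ?_, hs₁, hsign⟩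
  have hsr : 0 < s ^ r := Real.rpow_pos_of_pos hs r
  have hadd : s ^ (r + 1) = s * s ^ r := by rw [Real.rpow_add_one hs.ne', mul_comm]
  have h1 := hlow s ⟨hs, hss⟩
  have h2 := hup s ⟨hs, hss⟩
  obtain ⟨h3, h4⟩ := hb s ⟨hs, hss⟩
  rw [(hφ.hasDerivAt_mul hs).deriv] at h3 h4
  rw [hadd, mul_left_comm] at h1 h2
  have h1' := le_of_mul_le_mul_left h1 hs
  have h2' := le_of_mul_le_mul_left h2 hs
  exact ⟨(mul_le_mul_of_nonneg_right (min_le_right _ _) hsr.le).trans h1',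
    h2'.trans (mul_le_mul_of_nonneg_right (le_max_right _ _) hsr.le),
    (mul_le_mul_of_nonneg_right (min_le_left _ _) hsr.le).trans h3,
    h4.trans (mul_le_mul_of_nonneg_right (le_max_left _ _) hsr.le)⟩

/-- The gradient of `√φ(|u|) u` is controlled by those of `u` and `φ(|u|) u`. -/
lemma exists_sqrt_bound (hφ : Admissible φ) : ∃ C, 1 ≤ C ∧ ∀ s, 0 < s →
    √(φ s) * (1 + |phiLog φ s|) ≤ C * (1 + φ s * (1 + phiLog φ s)) := by
  obtain ⟨s₀, c, C, r, s₁, hs₀, hc, hC, -, hb, hs₁, hsign⟩ := hφ.exists_power_bounds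
  have hd : ∀ {s}, 0 < s → 0 < φ s * (1 + phiLog φ s) := fun {s} hs =>
    mul_pos (hφ.pos s hs) (by linarith [hφ.neg_one_lt_phiLog hs])
  -- Near the origin `φ` and `φ (1 + y)` are both comparable to `s ^ r`, so `y` is bounded and `√φ ≤
  -- 1 + φ` suffices.
  have hnear : ∃ K, ∀ s, 0 < s → s < s₀ →
      √(φ s) * (1 + |phiLog φ s|) ≤ K * (1 + φ s * (1 + phiLog φ s)) := by
    have hK : 0 < C / c := by positivity
    refine ⟨(2 + C / c) * (1 + C / c), fun s hs hss => ?_⟩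
    obtain ⟨h1, h2, h3, h4⟩ := hb s hs hss
    have hp := hφ.pos s hs
    have hy := hφ.neg_one_lt_phiLog hs
    have hCc : C = C / c * c := by field_simp
    have e1 : φ s * (1 + phiLog φ s) ≤ C / c * φ s := by
      calc _ ≤ C / c * c * s ^ r := by rw [← hCc]; exact h4
        _ = C / c * (c * s ^ r) := by ring
        _ ≤ _ := by gcongr
    have e2 : φ s ≤ C / c * (φ s * (1 + phiLog φ s)) := by
      calc _ ≤ C / c * c * s ^ r := by rw [← hCc]; exact h2
        _ = C / c * (c * s ^ r) := by ring
        _ ≤ _ := by gcongr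
    have e3 : 1 + phiLog φ s ≤ C / c := by
      rw [mul_comm (C / c)] at e1
      exact le_of_mul_le_mul_left e1 hp
    have e4 : 1 + |phiLog φ s| ≤ 2 + C / c := by
      have : |phiLog φ s| ≤ 1 + C / c := abs_le.2 ⟨by linarith, by linarith⟩
      linarith
    have e5 : √(φ s) ≤ 1 + φ s := by
      nlinarith [Real.sq_sqrt hp.le, sq_nonneg (√(φ s) - 1), Real.sqrt_nonneg (φ s)]
    have e6 : √(φ s) ≤ (1 + C / c) * (1 + φ s * (1 + phiLog φ s)) := by
      nlinarith [hd hs]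
    calc √(φ s) * (1 + |phiLog φ s|)
        ≤ ((1 + C / c) * (1 + φ s * (1 + phiLog φ s))) * (2 + C / c) := by
          have := hd hs
          gcongr
      _ = _ := by ring
  have hmid : ∃ K, ∀ s, s₀ ≤ s → s ≤ s₁ → √(φ s) * (1 + |phiLog φ s|) ≤ K := by
    have hsub : Icc s₀ s₁ ⊆ Ioi 0 := fun s hs => hs₀.trans_le hs.1
    obtain ⟨K, hK⟩ := isCompact_Icc.exists_bound_of_continuousOn
      ((hφ.continuousOn.sqrt.mul (continuousOn_const.add hφ.continuousOn_phiLog.abs)).mono hsub :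
        ContinuousOn (fun s => √(φ s) * (1 + |phiLog φ s|)) (Icc s₀ s₁))
    exact ⟨K, fun s h h' => (le_abs_self _).trans (hK s ⟨h, h'⟩)⟩
  have hs₁0 : 0 < s₁ := hs₀.trans hs₁
  have hfar : ∃ K, ∀ s, s₁ ≤ s →
      √(φ s) * (1 + |phiLog φ s|) ≤ K * (1 + φ s * (1 + phiLog φ s)) := by
    have hsub : Ici s₁ ⊆ Ioi 0 := fun s hs => hs₁0.trans_le hs
    have hcont := hφ.continuousOn.mono hsub
    rcases hsign with hpos | hneg
    -- Here `y ≥ 0` and `√φ` is bounded below, so one factor `√φ` can be absorbed into `φ (1 + y)`.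
    · have hmono : MonotoneOn φ (Ici s₁) := monotoneOn_of_deriv_nonneg (convex_Ici s₁) hcont
        (fun s hs => (hφ.differentiableAt
          (hsub (interior_subset hs))).differentiableWithinAt)
        (fun s hs => hpos s (interior_subset hs))
      refine ⟨(√(φ s₁))⁻¹, fun s hs => ?_⟩
      have hs0 : 0 < s := hs₁0.trans_le hs
      have hy : 0 ≤ phiLog φ s := div_nonneg (mul_nonneg hs0.le (hpos s hs)) (hφ.pos s hs0).le
      have hle : √(φ s₁) ≤ √(φ s) := Real.sqrt_le_sqrt (hmono self_mem_Ici hs hs)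
      have h1 : 0 < √(φ s₁) := Real.sqrt_pos.2 (hφ.pos _ hs₁0)
      rw [abs_of_nonneg hy, inv_mul_eq_div, le_div_iff₀ h1]
      have h2 : √(φ s) * √(φ s) = φ s := Real.mul_self_sqrt (hφ.pos s hs0).le
      calc √(φ s) * (1 + phiLog φ s) * √(φ s₁) ≤ √(φ s) * (1 + phiLog φ s) * √(φ s) := by gcongr
        _ = φ s * (1 + phiLog φ s) := by rw [mul_right_comm, h2]
        _ ≤ _ := by linarith
    -- Here `-1 < y ≤ 0` and `√φ` is bounded, so the left-hand side is bounded.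
    · have hanti : AntitoneOn φ (Ici s₁) := antitoneOn_of_deriv_nonpos (convex_Ici s₁) hcont
        (fun s hs => (hφ.differentiableAt
          (hsub (interior_subset hs))).differentiableWithinAt)
        (fun s hs => hneg s (interior_subset hs))
      refine ⟨2 * √(φ s₁), fun s hs => ?_⟩
      have hs0 : 0 < s := hs₁0.trans_le hs
      have hy : phiLog φ s ≤ 0 := div_nonpos_of_nonpos_of_nonneg
        (mul_nonpos_of_nonneg_of_nonpos hs0.le (hneg s hs)) (hφ.pos s hs0).le
      have hy' := hφ.neg_one_lt_phiLog hs0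
      have hle : √(φ s) ≤ √(φ s₁) := Real.sqrt_le_sqrt (hanti self_mem_Ici hs hs)
      have h1 : 1 + |phiLog φ s| ≤ 2 := by
        rw [abs_of_nonpos hy]
        linarith
      have h0 : 0 ≤ √(φ s₁) := Real.sqrt_nonneg _
      calc √(φ s) * (1 + |phiLog φ s|) ≤ √(φ s₁) * 2 := by gcongr
        _ ≤ 2 * √(φ s₁) * (1 + φ s * (1 + phiLog φ s)) := by nlinarith [mul_nonneg h0 (hd hs0).le]
  obtain ⟨K₁, hK₁⟩ := hnear
  obtain ⟨K₂, hK₂⟩ := hmid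
  obtain ⟨K₃, hK₃⟩ := hfar
  set K := max 1 (max K₁ (max K₂ K₃)) with hKdef
  have hK : 1 ≤ K := le_max_left _ _
  have l1 : K₁ ≤ K := (le_max_left _ _).trans (le_max_right _ _)
  have l2 : K₂ ≤ K := (le_max_left _ _).trans ((le_max_right _ _).trans (le_max_right _ _))
  have l3 : K₃ ≤ K := (le_max_right _ _).trans ((le_max_right _ _).trans (le_max_right _ _))
  refine ⟨K, hK, fun s hs => ?_⟩
  have hd0 := hd hs
  rcases lt_or_ge s s₀ with h | h
  · exact (hK₁ s hs h).trans (by gcongr)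
  rcases le_or_gt s s₁ with h' | h'
  · refine (hK₂ s h h').trans (l2.trans ?_)
    nlinarith
  · exact (hK₃ s h'.le).trans (by gcongr)

/-- Near the origin both `ζ(t) = t Θ(t)` and `t / Θ(t)` are bounded by a power of `t`. -/
lemma exists_zeta_bound (hφ : Admissible φ) : ∃ t₀ C α : ℝ, 0 < t₀ ∧ 0 < α ∧
    ∀ t, 0 < t → t < t₀ → t * Theta φ t ≤ C * t ^ α ∧ t * (Theta φ t)⁻¹ ≤ C * t ^ α := by
  obtain ⟨s₀, c, C, r, -, hs₀, hc, hC, hr, hb, -⟩ := hφ.exists_power_bounds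
  have hr2 : 0 < r + 2 := by linarith
  have hr1 : 0 < r + 1 := by linarith
  set p : ℝ := (r + 2)⁻¹
  have hp : 0 < p := by positivity
  set α : ℝ := min (2 * p) (2 * p * (r + 1))
  have hα : 0 < α := lt_min (by positivity) (by positivity)
  set K₁ : ℝ := (c⁻¹) ^ p
  set K₂ : ℝ := C * K₁ ^ (r + 1)
  have hK₁ : 0 < K₁ := by positivity
  have hK₂ : 0 < K₂ := by positivity
  refine ⟨min 1 (s₀ * √(φ s₀)), max K₁ K₂, α, lt_min one_pos (hφ.mul_sqrt_pos hs₀), hα,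
    fun t ht htt => ?_⟩
  set s := zeta φ t
  have hs : 0 < s := hφ.zeta_pos ht
  have hgs : s * √(φ s) = t := hφ.zeta_mul_sqrt ht
  have hss : s < s₀ := by
    rw [← hφ.strictMonoOn_mul_sqrt.lt_iff_lt (mem_Ioi.2 hs) (mem_Ioi.2 hs₀)]
    rw [hgs]
    exact htt.trans_le (min_le_right _ _)
  have ht1 : t ≤ 1 := htt.le.trans (min_le_left _ _)
  obtain ⟨h1, h2, -, -⟩ := hb s hs hss
  have hsr : 0 < s ^ r := Real.rpow_pos_of_pos hs r
  have hsq : t ^ 2 = s * (s * φ s) := by rw [← hgs, hφ.mul_sqrt_sq hs]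
  -- From `t² = s² φ(s) ≥ c s ^ (r + 2)`. Hence `s` is controlled by `t ^ (2 / (r + 2))` and `s
  -- φ(s)` by `t ^ (2 (r + 1) / (r + 2))`, both positive powers.
  have hpow : s ^ (r + 2) ≤ c⁻¹ * t ^ 2 := by
    have : s ^ (r + 2) = s * (s * s ^ r) := by
      rw [Real.rpow_add hs, Real.rpow_two]
      ring
    rw [this, hsq, inv_mul_eq_div, le_div_iff₀ hc]
    calc s * (s * s ^ r) * c = s * (s * (c * s ^ r)) := by ring
      _ ≤ s * (s * φ s) := by gcongr
  have hs_le : s ≤ K₁ * t ^ (2 * p) := by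
    have h3 : (s ^ (r + 2)) ^ p ≤ (c⁻¹ * t ^ 2) ^ p :=
      Real.rpow_le_rpow (by positivity) hpow hp.le
    rw [← Real.rpow_mul hs.le, mul_inv_cancel₀ hr2.ne', Real.rpow_one,
      Real.mul_rpow (by positivity) (by positivity), ← Real.rpow_two, ← Real.rpow_mul ht.le] at h3
    exact h3
  have hζ : t * Theta φ t = s := by
    rw [Theta]
    field_simp
    rfl
  have hζ' : t * (Theta φ t)⁻¹ = s * φ s := by
    rw [Theta, inv_div]
    change t * (t / s) = s * φ s
    rw [← mul_div_assoc, ← sq, hsq]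
    field_simp
  have htα : ∀ β, α ≤ β → t ^ β ≤ t ^ α := fun β hβ => Real.rpow_le_rpow_of_exponent_ge ht ht1 hβ
  have htα0 : 0 < t ^ α := Real.rpow_pos_of_pos ht α
  rw [hζ, hζ']
  constructor
  · calc s ≤ K₁ * t ^ (2 * p) := hs_le
      _ ≤ K₁ * t ^ α := mul_le_mul_of_nonneg_left (htα _ (min_le_left _ _)) hK₁.le
      _ ≤ _ := by gcongr; exact le_max_left _ _
  · calc s * φ s ≤ s * (C * s ^ r) := by gcongr
      _ = C * s ^ (r + 1) := by rw [Real.rpow_add_one hs.ne']; ring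
      _ ≤ C * (K₁ * t ^ (2 * p)) ^ (r + 1) := by gcongr
      _ = K₂ * t ^ (2 * p * (r + 1)) := by
        rw [Real.mul_rpow hK₁.le (by positivity), ← Real.rpow_mul ht.le]
        ring
      _ ≤ K₂ * t ^ α := mul_le_mul_of_nonneg_left (htα _ (min_le_right _ _)) hK₂.le
      _ ≤ _ := by gcongr; exact le_max_right _ _

end Admissible

/-! ### Damped compositions with `Θ` and `1/Θ`. -/

/-- `X` is a positive function on `(0, ∞)` whose logarithmic derivative `L = t X'(t) / X(t)` is
continuous and takes values in `[-1, 1]`. -/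
structure LogProfile (X L : ℝ → ℝ) : Prop where
  pos : ∀ t, 0 < t → 0 < X t
  hasDerivAt : ∀ t, 0 < t → HasDerivAt X (X t * L t / t) t
  continuousOn : ContinuousOn L (Ioi 0)
  abs_le : ∀ t, 0 < t → |L t| ≤ 1

lemma Admissible.logProfile {φ : ℝ → ℝ} (hφ : Admissible φ) : LogProfile (Theta φ) (Lam φ) :=
  ⟨fun _ ht => hφ.Theta_pos ht, fun _ ht => hφ.hasDerivAt_Theta ht, hφ.continuousOn_Lam,
    fun _ ht => hφ.abs_Lam_le ht⟩

namespace LogProfile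

variable {X L : ℝ → ℝ}

/-- This allows `u` and `φ(|u|) u` to be treated by one argument, with `X = Θ` and `X = 1/Θ`. -/
lemma inv (h : LogProfile X L) : LogProfile (fun t => (X t)⁻¹) (fun t => -L t) := by
  refine ⟨fun t ht => inv_pos.2 (h.pos t ht), fun t ht => ?_, h.continuousOn.neg,
    fun t ht => (abs_neg _).trans_le (h.abs_le t ht)⟩
  have hX := (h.pos t ht).ne'
  refine ((h.hasDerivAt t ht).inv hX).congr_deriv ?_
  field_simp

lemma monotoneOn_mul (h : LogProfile X L) : MonotoneOn (fun t => t * X t) (Ioi 0) := by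
  have hd : ∀ t, 0 < t → HasDerivAt (fun t => t * X t) (X t * (1 + L t)) t := fun t ht => by
    refine ((hasDerivAt_id t).mul (h.hasDerivAt t ht)).congr_deriv ?_
    simp only [id]
    field_simp
  refine monotoneOn_of_deriv_nonneg (convex_Ioi 0)
    (fun t ht => (hd t ht).continuousAt.continuousWithinAt) ?_ ?_ <;> rw [interior_Ioi]
  · exact fun t ht => (hd t ht).differentiableAt.differentiableWithinAt
  · intro t ht
    rw [(hd t ht).deriv]
    exact mul_nonneg (h.pos t ht).le (by linarith [(_root_.abs_le.1 (h.abs_le t ht)).1])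

/-- Composition with `ψ(t) = t β(t)` for a damping factor `β` of sufficiently high order gives a
radial profile. -/
lemma radialProfile_damp (h : LogProfile X L) {t₀ C α : ℝ} (ht₀ : 0 < t₀)
    (hα : 0 < α) (hbound : ∀ t, 0 < t → t < t₀ → t * X t ≤ C * t ^ α) {q : ℕ}
    (hq : 2 ≤ ((q : ℝ) + 1) * α) {ε : ℝ} (hε : 0 < ε) :
    RadialProfile (fun t => X (t * damp q ε t) * damp q ε t)
      (fun t => X (t * damp q ε t) * damp q ε t *
        (L (t * damp q ε t) * (1 + dampLog q ε t) + dampLog q ε t)) := by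
  have hψ : ∀ t, 0 < t → 0 < t * damp q ε t := fun t ht => mul_pos ht (damp_pos hε ht)
  have hψd : ∀ t, 0 < t → HasDerivAt (fun t => t * damp q ε t)
      (damp q ε t * (1 + dampLog q ε t)) t := fun t ht => by
    refine ((hasDerivAt_id t).mul (hasDerivAt_damp hε ht)).congr_deriv ?_
    simp only [id]
    field_simp
  have hψc : ContinuousOn (fun t => t * damp q ε t) (Ioi 0) := fun t ht =>
    (hψd t ht).continuousAt.continuousWithinAt
  have hbd : ∀ t, 0 < t → HasDerivAt (fun t => X (t * damp q ε t) * damp q ε t)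
      (X (t * damp q ε t) * damp q ε t *
        (L (t * damp q ε t) * (1 + dampLog q ε t) + dampLog q ε t) / t) t := fun t ht => by
    have h1 := ((h.hasDerivAt _ (hψ t ht)).comp t (hψd t ht)).mul (hasDerivAt_damp (q := q) hε ht)
    refine h1.congr_deriv ?_
    have := (damp_pos (q := q) hε ht).ne'
    simp only [Function.comp]
    field_simp
  have hLc : ContinuousOn (fun t => L (t * damp q ε t)) (Ioi 0) := h.continuousOn.comp hψc hψ
  refine ⟨hbd, ContinuousOn.mul (fun t ht => (hbd t ht).continuousAt.continuousWithinAt)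
    ((hLc.mul (continuousOn_const.add (continuousOn_dampLog hε))).add (continuousOn_dampLog hε)),
    ?_⟩
  -- The function `t X(t)` is increasing and the damped modulus never exceeds `ε⁻¹`.
  set S := ε⁻¹ * X ε⁻¹
  have hεi : 0 < ε⁻¹ := inv_pos.2 hε
  have hS0 : 0 < S := mul_pos hεi (h.pos _ hεi)
  have hS : ∀ t, 0 < t → t * damp q ε t * X (t * damp q ε t) ≤ S := fun t ht =>
    h.monotoneOn_mul (mem_Ioi.2 (hψ t ht)) (mem_Ioi.2 hεi) (mul_damp_le hε ht)
  set D := max C (S * (t₀ ^ α)⁻¹)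
  have ht₀α : 0 < t₀ ^ α := Real.rpow_pos_of_pos ht₀ α
  -- `D` extends the power bound past `t₀`, where `S` is already at most `S (t₀ ^ α)⁻¹` times the
  -- power.
  have hD0 : 0 < D := lt_max_of_lt_right (by positivity)
  have hD : ∀ t, 0 < t →
      t * damp q ε t * X (t * damp q ε t) ≤ D * (t * damp q ε t) ^ α := fun t ht => by
    have hpα : 0 < (t * damp q ε t) ^ α := Real.rpow_pos_of_pos (hψ t ht) α
    rcases lt_or_ge (t * damp q ε t) t₀ with hlt | hge
    · exact (hbound _ (hψ t ht) hlt).trans (by gcongr; exact le_max_left _ _)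
    · calc _ ≤ S := hS t ht
        _ = S * (t₀ ^ α)⁻¹ * t₀ ^ α := by field_simp
        _ ≤ D * (t * damp q ε t) ^ α := by
          gcongr
          exact le_max_right _ _
  set K := D * (ε⁻¹ ^ q) ^ α
  have hK0 : 0 < K := by positivity
  -- The damped modulus is `O(t ^ (q + 1))`, so its power `α` is `O(t²)` by the choice of `q`;
  -- division by `t` leaves the flatness `O(t)` that a radial profile needs.
  have hK : ∀ t, 0 < t → t ≤ 1 → t * damp q ε t * X (t * damp q ε t) ≤ K * t ^ 2 :=
    fun t ht ht1 => by
      have h1 : t * damp q ε t ≤ ε⁻¹ ^ q * t ^ (q + 1) := by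
        calc t * damp q ε t ≤ t * (t / ε) ^ q := by gcongr; exact damp_le_pow hε ht
          _ = ε⁻¹ ^ q * t ^ (q + 1) := by rw [div_pow, inv_pow]; field_simp; ring
      have h2 : (t ^ (q + 1)) ^ α ≤ t ^ 2 := by
        rw [← Real.rpow_natCast, ← Real.rpow_mul ht.le, ← Real.rpow_two]
        refine Real.rpow_le_rpow_of_exponent_ge ht ht1 ?_
        push_cast
        exact hq
      calc _ ≤ D * (t * damp q ε t) ^ α := hD t ht
        _ ≤ D * (ε⁻¹ ^ q * t ^ (q + 1)) ^ α := by
          have := (hψ t ht).le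
          gcongr
        _ = K * (t ^ (q + 1)) ^ α := by
          rw [Real.mul_rpow (by positivity) (by positivity)]
          ring
        _ ≤ K * t ^ 2 := by gcongr
  have hq0 : (0 : ℝ) ≤ q := q.cast_nonneg
  refine ⟨(K + S) * (2 * q + 3), fun t ht => ?_⟩
  have hX := h.pos _ (hψ t ht)
  have hp := damp_pos (q := q) hε ht
  have hb0 : 0 < X (t * damp q ε t) * damp q ε t := mul_pos hX hp
  have hbeq : t * damp q ε t * X (t * damp q ε t) = X (t * damp q ε t) * damp q ε t * t := by ring
  have hb : X (t * damp q ε t) * damp q ε t ≤ K + S ∧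
      X (t * damp q ε t) * damp q ε t ≤ (K + S) * t := by
    rcases le_or_gt t 1 with ht1 | ht1
    · have h1 := hK t ht ht1
      rw [hbeq, sq, ← mul_assoc] at h1
      have h2 := le_of_mul_le_mul_right h1 ht
      constructor <;> nlinarith
    · have h1 := hS t ht
      rw [hbeq] at h1
      constructor <;> nlinarith
  have he := abs_dampLog_le (q := q) hε ht
  have hc : |L (t * damp q ε t) * (1 + dampLog q ε t) + dampLog q ε t| ≤ 2 * q + 3 := by
    refine (abs_add_le _ _).trans ?_
    rw [abs_mul]
    have h1 : |1 + dampLog q ε t| ≤ 1 + (q + 1) := (abs_add_le _ _).trans (by rw [abs_one]; gcongr)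
    have h2 := h.abs_le _ (hψ t ht)
    nlinarith [abs_nonneg (1 + dampLog q ε t), abs_nonneg (L (t * damp q ε t))]
  rw [abs_mul (X (t * damp q ε t) * damp q ε t) (_ + _), abs_of_pos hb0]
  have aux : ∀ Y : ℝ, 0 ≤ Y → Y ≤ Y * (2 * q + 3) := fun Y hY => by nlinarith [mul_nonneg hq0 hY]
  refine ⟨hb.1.trans (aux _ (by positivity)), ?_, ?_, ?_⟩
  · rw [mul_right_comm (K + S)]
    exact hb.2.trans (aux _ (by positivity))
  · exact mul_le_mul hb.1 hc (abs_nonneg _) (by positivity)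
  · rw [mul_right_comm (K + S)]
    exact mul_le_mul hb.2 hc (abs_nonneg _) (by positivity)

end LogProfile

/-! ### Algebra of the Hermitian form. -/

section Algebra

lemma herm_re (a b : CVec m) : (herm a b).re = inner ℝ a b := by
  simp only [herm, PiLp.inner_apply, RCLike.inner_apply, Complex.re_sum]
  refine Finset.sum_congr rfl fun i _ => ?_
  simp
  ring

lemma act_add (M : Matrix (Fin m) (Fin m) ℂ) (a b : CVec m) :
    act M (a + b) = act M a + act M b := by
  simp [act, Matrix.mulVec_add]

lemma act_smul (M : Matrix (Fin m) (Fin m) ℂ) (c : ℝ) (a : CVec m) :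
    act M (c • a) = (c : ℂ) • act M a := by
  simp only [act, WithLp.ofLp_smul]
  rw [← WithLp.toLp_smul, ← Matrix.mulVec_smul]
  rfl

lemma act_sub_left (M M' : Matrix (Fin m) (Fin m) ℂ) (a : CVec m) :
    act (M - M') a = act M a - act M' a := by
  simp [act, Matrix.sub_mulVec]

lemma herm_add_left (a a' b : CVec m) : herm (a + a') b = herm a b + herm a' b :=
  inner_add_right _ _ _

lemma herm_sub_left (a a' b : CVec m) : herm (a - a') b = herm a b - herm a' b :=
  inner_sub_right _ _ _

lemma herm_sub_right (a b b' : CVec m) : herm a (b - b') = herm a b - herm a b' :=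
  inner_sub_left _ _ _

lemma herm_smul_left (c : ℂ) (a b : CVec m) : herm (c • a) b = c * herm a b :=
  inner_smul_right _ _ _

lemma herm_smul_right (c : ℝ) (a b : CVec m) : herm a (c • b) = c * herm a b := by
  have : c • b = (c : ℂ) • b := (Complex.coe_smul c b).symm
  rw [this, herm, inner_smul_left, Complex.conj_ofReal]
  rfl

lemma herm_act_smul (M : Matrix (Fin m) (Fin m) ℂ) (c d : ℝ) (a b : CVec m) :
    herm (act M (c • a)) (d • b) = ((c * d : ℝ) : ℂ) * herm (act M a) b := by
  rw [act_smul, herm_smul_left, herm_smul_right]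
  push_cast
  ring

lemma herm_act (M : Matrix (Fin m) (Fin m) ℂ) (a b : CVec m) :
    herm (act M a) b = ∑ i, ∑ j, M i j * a j * star (b i) := by
  simp only [herm, act, PiLp.inner_apply, RCLike.inner_apply, Matrix.mulVec, dotProduct,
    Finset.sum_mul]
  rfl

/-- The two complex numbers are conjugate, so only their real parts agree. -/
lemma herm_act_conjTranspose_re (M : Matrix (Fin m) (Fin m) ℂ) (a b : CVec m) :
    (herm (act Mᴴ a) b).re = (herm (act M b) a).re := by
  rw [herm_act, herm_act, Finset.sum_comm]
  simp only [Complex.re_sum]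
  refine Finset.sum_congr rfl fun i _ => Finset.sum_congr rfl fun j _ => ?_
  simp [Matrix.conjTranspose_apply]
  ring

lemma norm_herm_act_le (M : Matrix (Fin m) (Fin m) ℂ) (a b : CVec m) :
    ‖herm (act M a) b‖ ≤ (∑ i, ∑ j, ‖M i j‖) * (‖a‖ * ‖b‖) := by
  rw [herm_act, Finset.sum_mul]
  refine (norm_sum_le _ _).trans (Finset.sum_le_sum fun i _ => ?_)
  rw [Finset.sum_mul]
  refine (norm_sum_le _ _).trans (Finset.sum_le_sum fun j _ => ?_)
  rw [norm_mul, norm_mul, norm_star, mul_assoc]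
  gcongr
  · exact PiLp.norm_apply_le a j
  · exact PiLp.norm_apply_le b i

end Algebra

/-! ### Integrability and continuity of the coefficient form. -/

/-- The sesquilinear expression `∑ ⟨𝒜^{hk} a_k, b_h⟩`. -/
noncomputable def coeffForm (A : Coeff N m) (a b : Fin N → Pt N → CVec m) (x : Pt N) : ℂ :=
  ∑ h, ∑ k, herm (act (A h k x) (a k x)) (b h x)

section Integrability

variable {μ : Measure (Pt N)}

lemma aestronglyMeasurable_herm_act {M : Pt N → Matrix (Fin m) (Fin m) ℂ}
    (hM : ∀ i j, AEStronglyMeasurable (fun x => M x i j) μ) {a b : Pt N → CVec m}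
    (ha : AEStronglyMeasurable a μ) (hb : AEStronglyMeasurable b μ) :
    AEStronglyMeasurable (fun x => herm (act (M x) (a x)) (b x)) μ := by
  have hc : ∀ {a : Pt N → CVec m}, AEStronglyMeasurable a μ → ∀ i,
      AEStronglyMeasurable (fun x => a x i) μ := fun ha i =>
    (EuclideanSpace.proj (𝕜 := ℂ) i).continuous.comp_aestronglyMeasurable ha
  simp only [herm_act]
  refine Finset.aestronglyMeasurable_fun_sum _ fun i _ =>
    Finset.aestronglyMeasurable_fun_sum _ fun j _ => ?_
  exact ((hM i j).mul (hc ha j)).mul (continuous_star.comp_aestronglyMeasurable (hc hb i))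

lemma integrable_entrySum_mul {M : Pt N → Matrix (Fin m) (Fin m) ℂ}
    (hM : ∀ i j, MemLp (fun x => M x i j) ⊤ μ) {a b : Pt N → ℝ}
    (ha : MemLp a 2 μ) (hb : MemLp b 2 μ) :
    Integrable (fun x => (∑ i, ∑ j, ‖M x i j‖) * (a x * b x)) μ := by
  have h1 : MemLp (fun x => ∑ i, ∑ j, ‖M x i j‖) ⊤ μ :=
    memLp_finsetSum _ fun i _ => memLp_finsetSum _ fun j _ => (hM i j).norm
  have h2 : MemLp (fun x => a x * b x) 1 μ := hb.mul (r := 1) ha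
  exact memLp_one_iff_integrable.1 (h2.mul (r := 1) h1)

lemma integrable_herm_act {M : Pt N → Matrix (Fin m) (Fin m) ℂ}
    (hM : ∀ i j, MemLp (fun x => M x i j) ⊤ μ) {a b : Pt N → CVec m}
    (ha : MemLp a 2 μ) (hb : MemLp b 2 μ) :
    Integrable (fun x => herm (act (M x) (a x)) (b x)) μ :=
  (integrable_entrySum_mul hM ha.norm hb.norm).mono'
    (aestronglyMeasurable_herm_act (fun i j => (hM i j).aestronglyMeasurable)
      ha.aestronglyMeasurable hb.aestronglyMeasurable)
    (.of_forall fun _ => norm_herm_act_le _ _ _)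

variable {A : Coeff N m}

lemma integrable_coeffForm (hA : BoundedCoeff Ω A) {a b : Fin N → Pt N → CVec m}
    (ha : ∀ k, MemLp (a k) 2 (volume.restrict Ω)) (hb : ∀ k, MemLp (b k) 2 (volume.restrict Ω)) :
    Integrable (coeffForm A a b) (volume.restrict Ω) :=
  integrable_finsetSum _ fun h _ => integrable_finsetSum _ fun k _ =>
    integrable_herm_act (hA h k) (ha k) (hb h)

lemma tendsto_integral_coeffForm (hA : BoundedCoeff Ω A) {a b : Fin N → Pt N → CVec m}
    {an bn : ℕ → Fin N → Pt N → CVec m} {B : Fin N → Pt N → ℝ}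
    (hB : ∀ k, MemLp (B k) 2 (volume.restrict Ω))
    (han : ∀ n k, AEStronglyMeasurable (an n k) (volume.restrict Ω))
    (hbn : ∀ n k, AEStronglyMeasurable (bn n k) (volume.restrict Ω))
    (haB : ∀ n k x, ‖an n k x‖ ≤ B k x) (hbB : ∀ n k x, ‖bn n k x‖ ≤ B k x)
    (ha : ∀ᵐ x ∂(volume.restrict Ω), ∀ k, Tendsto (fun n => an n k x) atTop (𝓝 (a k x)))
    (hb : ∀ᵐ x ∂(volume.restrict Ω), ∀ k, Tendsto (fun n => bn n k x) atTop (𝓝 (b k x))) :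
    Tendsto (fun n => ∫ x in Ω, coeffForm A (an n) (bn n) x) atTop
      (𝓝 (∫ x in Ω, coeffForm A a b x)) := by
  refine tendsto_integral_of_dominated_convergence
    (fun x => ∑ h, ∑ k, (∑ i, ∑ j, ‖A h k x i j‖) * (B k x * B h x)) (fun n => ?_)
    (integrable_finsetSum _ fun h _ => integrable_finsetSum _ fun k _ =>
      integrable_entrySum_mul (hA h k) (hB k) (hB h)) (fun n => .of_forall fun x => ?_) ?_
  · exact Finset.aestronglyMeasurable_fun_sum _ fun h _ =>
      Finset.aestronglyMeasurable_fun_sum _ fun k _ => aestronglyMeasurable_herm_act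
        (fun i j => (hA h k i j).aestronglyMeasurable) (han n k) (hbn n h)
  · refine (norm_sum_le _ _).trans (Finset.sum_le_sum fun h _ => ?_)
    refine (norm_sum_le _ _).trans (Finset.sum_le_sum fun k _ => ?_)
    refine (norm_herm_act_le _ _ _).trans ?_
    have := (norm_nonneg _).trans (haB n k x)
    gcongr
    · exact haB n k x
    · exact hbB n h x
  · filter_upwards [ha, hb] with x hax hbx
    refine tendsto_finsetSum _ fun h _ => tendsto_finsetSum _ fun k _ => ?_
    have hc : ∀ {c : ℕ → CVec m} {c' : CVec m}, Tendsto c atTop (𝓝 c') → ∀ i,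
        Tendsto (fun n => c n i) atTop (𝓝 (c' i)) := fun h i =>
      ((EuclideanSpace.proj (𝕜 := ℂ) i).continuous.tendsto _).comp h
    simp only [herm_act]
    refine tendsto_finsetSum _ fun i _ => tendsto_finsetSum _ fun j _ => ?_
    exact ((hc (hax k) j).const_mul _).mul ((continuous_star.tendsto _).comp (hc (hbx h) i))

end Integrability

/-! ### The radial correction term and the functional `J`. -/

section LamProj

/-- The map `h ↦ Λ(|z|) |z|⁻² Re⟨z, h⟩ z`. -/
noncomputable def lamProj (φ : ℝ → ℝ) (z h : CVec m) : CVec m := Lam φ ‖z‖ • radProj z h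

@[simp] lemma lamProj_zero_left (h : CVec m) : lamProj φ 0 h = 0 := by simp [lamProj]

lemma norm_lamProj_le (hφ : Admissible φ) (z h : CVec m) : ‖lamProj φ z h‖ ≤ ‖h‖ := by
  rcases eq_or_ne z 0 with rfl | hz
  · simp
  rw [lamProj, norm_smul, Real.norm_eq_abs]
  have := hφ.abs_Lam_le (norm_pos_iff.2 hz)
  have h2 := norm_radProj_apply_le z h
  nlinarith [abs_nonneg (Lam φ ‖z‖), norm_nonneg (radProj z h)]

lemma tendsto_lamProj (hφ : Admissible φ) {zn hn : ℕ → CVec m} {z h : CVec m} (hz : z ≠ 0)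
    (hzn : Tendsto zn atTop (𝓝 z)) (hhn : Tendsto hn atTop (𝓝 h)) :
    Tendsto (fun n => lamProj φ (zn n) (hn n)) atTop (𝓝 (lamProj φ z h)) := by
  have h1 : Tendsto (fun n => Lam φ ‖zn n‖) atTop (𝓝 (Lam φ ‖z‖)) :=
    (hφ.continuousOn_Lam.continuousAt (Ioi_mem_nhds (norm_pos_iff.2 hz))).tendsto.comp hzn.norm
  have h2 : Tendsto (fun n => ((‖zn n‖ ^ 2)⁻¹ * inner ℝ (zn n) (hn n)) • zn n) atTop
      (𝓝 (((‖z‖ ^ 2)⁻¹ * inner ℝ z h) • z)) :=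
    (((hzn.norm.pow 2).inv₀ (pow_ne_zero 2 (norm_ne_zero_iff.2 hz))).mul
      (hzn.inner hhn)).smul hzn
  simp only [lamProj, radProj_apply]
  exact h1.smul h2

lemma measurable_lamProj (hφ : Admissible φ) :
    Measurable fun p : CVec m × CVec m => lamProj φ p.1 p.2 := by
  classical
  -- `Λ` is controlled only on `(0, ∞)`; replacing it by zero elsewhere changes nothing, since the
  -- projection vanishes at `z = 0`.
  have h1 : Measurable ((Ioi (0 : ℝ)).piecewise (Lam φ) 0) :=
    hφ.continuousOn_Lam.measurable_piecewise continuousOn_const measurableSet_Ioi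
  have h2 : (fun p : CVec m × CVec m => lamProj φ p.1 p.2) = fun p =>
      ((Ioi (0 : ℝ)).piecewise (Lam φ) 0) ‖p.1‖ •
        (((‖p.1‖ ^ 2)⁻¹ * inner ℝ p.1 p.2) • p.1) := by
    ext1 p
    rcases eq_or_ne p.1 0 with hp | hp
    · simp [hp]
    · rw [piecewise_eq_of_mem _ _ _ (mem_Ioi.2 (norm_pos_iff.2 hp)), lamProj, radProj_apply]
  rw [h2]
  have h3 : Measurable fun p : CVec m × CVec m => (inner ℝ p.1 p.2 : ℝ) :=
    (continuous_fst.inner continuous_snd).measurable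
  exact (h1.comp measurable_fst.norm).smul
    ((((measurable_fst.norm.pow_const 2).inv).mul h3).smul measurable_fst)

lemma aestronglyMeasurable_lamProj (hφ : Admissible φ) {μ : Measure (Pt N)}
    {v g : Pt N → CVec m} (hv : AEStronglyMeasurable v μ) (hg : AEStronglyMeasurable g μ) :
    AEStronglyMeasurable (fun x => lamProj φ (v x) (g x)) μ :=
  ((measurable_lamProj hφ).comp_aemeasurable
    (hv.aemeasurable.prodMk hg.aemeasurable)).aestronglyMeasurable

lemma memLp_lamProj (hφ : Admissible φ) {μ : Measure (Pt N)} {v g : Pt N → CVec m}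
    (hv : AEStronglyMeasurable v μ) (hg : MemLp g 2 μ) :
    MemLp (fun x => lamProj φ (v x) (g x)) 2 μ :=
  hg.mono (aestronglyMeasurable_lamProj hφ hv hg.aestronglyMeasurable)
    (.of_forall fun _ => norm_lamProj_le hφ _ _)

end LamProj

/-- The functional is the integral of `∑ ⟨𝒜^{hk} (p_k + q_k), p_h - q_h⟩`, where `p = ∇v` and
`q_k = Λ(|v|) |v|⁻² Re⟨v, ∂_k v⟩ v`. -/
lemma functional_eq (hΩ : IsOpen Ω) {φ : ℝ → ℝ} (hφ : Admissible φ) {A : Coeff N m}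
    (hA : BoundedCoeff Ω A) {v : Pt N → CVec m} {g : Fin N → Pt N → CVec m}
    (hv : HasH10Grad Ω v g) :
    functional Ω φ A v = (∫ x in Ω, coeffForm A (fun k x => g k x + lamProj φ (v x) (g k x))
      (fun k x => g k x - lamProj φ (v x) (g k x)) x).re := by
  set q : Fin N → Pt N → CVec m := fun k x => lamProj φ (v x) (g k x)
  have hq : ∀ k, MemLp (q k) 2 (volume.restrict Ω) := fun k =>
    memLp_lamProj hφ hv.memLp.aestronglyMeasurable (hv.memLp_grad k)
  have hp := hv.memLp_grad
  set F : Pt N → ℂ := fun x => ∑ h, ∑ k, (herm (act (A h k x) (g k x)) (g h x)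
    + herm (act (A h k x - (A k h x)ᴴ) (q k x)) (g h x) - herm (act (A h k x) (q k x)) (q h x))
  have hF : Integrable F (volume.restrict Ω) := by
    refine integrable_finsetSum _ fun h _ => integrable_finsetSum _ fun k _ => ?_
    refine ((integrable_herm_act (hA h k) (hp k) (hp h)).add
      (integrable_herm_act (fun i j => ?_) (hq k) (hp h))).sub
      (integrable_herm_act (hA h k) (hq k) (hq h))
    exact (hA h k i j).sub (hA k h j i).star
  have hFeq : {y | v y ≠ 0}.indicator (functionalIntegrand Ω φ A v) =ᵐ[volume.restrict Ω] F := by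
    filter_upwards [ae_all_iff.2 fun k => hv.weakPartial_ae_eq hΩ k, hv.ae_eq_zero hΩ]
      with x hx hx0
    -- The extension by zero is consistent with `F`, because the gradient vanishes almost everywhere
    -- on the zero set of `v`.
    by_cases hvx : v x = 0
    · rw [indicator_of_notMem (by simpa using hvx)]
      have hz : ∀ M : Matrix (Fin m) (Fin m) ℂ, herm (act M 0) (0 : CVec m) = 0 := fun M => by
        simp [herm]
      simp [F, q, hvx, hx0 hvx, hz]
    · rw [indicator_of_mem (by simpa using hvx)]
      simp only [functionalIntegrand, F, hx]
      refine Finset.sum_congr rfl fun h _ => Finset.sum_congr rfl fun k _ => ?_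
      have hqk : ∀ k, q k x = (Lam φ ‖v x‖ * ((‖v x‖ ^ 2)⁻¹ * (herm (v x) (g k x)).re)) • v x :=
        fun k => by simp only [q, lamProj, radProj_apply, herm_re, smul_smul]
      rw [hqk k, hqk h, herm_act_smul]
      have h1 := herm_act_smul (A h k x - (A k h x)ᴴ)
        (Lam φ ‖v x‖ * ((‖v x‖ ^ 2)⁻¹ * (herm (v x) (g k x)).re)) 1 (v x) (g h x)
      rw [one_smul] at h1
      rw [h1]
      have h4 : (‖v x‖ ^ 4)⁻¹ = (‖v x‖ ^ 2)⁻¹ * (‖v x‖ ^ 2)⁻¹ := by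
        rw [← mul_inv]
        ring
      rw [h4]
      push_cast
      ring
  have hre : ∀ x, (F x).re = (coeffForm A (fun k x => g k x + q k x)
      (fun k x => g k x - q k x) x).re := by
    intro x
    simp only [F, coeffForm, act_add, act_sub_left, herm_add_left, herm_sub_left, herm_sub_right,
      Complex.re_sum, Complex.add_re, Complex.sub_re, herm_act_conjTranspose_re,
      Finset.sum_add_distrib, Finset.sum_sub_distrib]
    -- Exchanging `h` and `k` turns the adjoint term into the cross term `⟨𝒜^{hk} p_k, q_h⟩`.
    rw [Finset.sum_comm (f := fun h k => (herm (act (A k h x) (g h x)) (q k x)).re)]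
    ring
  have hS := integrable_coeffForm hA (fun k => (hp k).add (hq k)) (fun k => (hp k).sub (hq k))
  rw [functional, integral_congr_ae hFeq]
  have e1 := integral_re hF
  have e2 := integral_re hS
  simp only [RCLike.re_to_complex] at e1 e2
  rw [← e1]
  refine Eq.trans (integral_congr_ae (.of_forall hre)) e2

/-! ### Gradients of `φ(|u|) u` and `√φ(|u|) u`. -/

section NonlinearGradient

variable {u : Pt N → CVec m} {gu gw : Fin N → Pt N → CVec m}

/-- The chain rule for `φ(|u|) u`, known to lie in `H¹₀`. -/
lemma phiMul_grad (hΩ : IsOpen Ω) (hφ : Admissible φ) (hu : HasH10Grad Ω u gu)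
    (hw : HasH10Grad Ω (phiMul φ u) gw) :
    ∀ᵐ x ∂(volume.restrict Ω), u x ≠ 0 → ∀ k,
      gw k x = φ ‖u x‖ • (gu k x + phiLog φ ‖u x‖ • radProj (u x) (gu k x)) := by
  -- The cutoff acts on `|φ(|u|) u| = s φ(s)`, so the truncated function is a radial image both of
  -- `φ(|u|) u` and of `u`; its two gradients must agree.
  set b : ℕ → ℝ → ℝ := fun n s => logCut n (s * φ s) * φ s
  set c : ℕ → ℝ → ℝ := fun n s => logCutDeriv n (s * φ s) * (1 + phiLog φ s) * φ s
    + logCut n (s * φ s) * (φ s * phiLog φ s)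
  have hsφ : ∀ s, 0 < s → 0 < s * φ s := fun s hs => mul_pos hs (hφ.pos s hs)
  have hprof : ∀ n, RadialProfile (b n) (c n) := by
    intro n
    have hinv : ∀ t, 0 < t → ∃ s, 0 < s ∧ s * φ s = t := fun t ht => by
      have : t ∈ (fun s => s * φ s) '' Ioi 0 := by rw [hφ.range_eq]; exact ht
      obtain ⟨s, hs, hst⟩ := this
      exact ⟨s, hs, hst⟩
    obtain ⟨α, hα, hfα⟩ := hinv (Real.exp (-(2 * (n + 1)))) (Real.exp_pos _)
    obtain ⟨β, hβ, hfβ⟩ := hinv (Real.exp (2 * (n + 1))) (Real.exp_pos _)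
    have hmulc : ContinuousOn (fun s => s * φ s) (Ioi 0) := continuousOn_id.mul hφ.continuousOn
    refine .of_eq_zero (α := α) (β := β) hα (fun s hs => ?_) ?_ fun s hs hmem => ?_
    · have h1 := ((hasDerivAt_logCut n (hsφ s hs)).comp s (hφ.hasDerivAt_mul hs)).mul
        (hφ.hasDerivAt hs)
      refine h1.congr_deriv ?_
      have := (hφ.pos s hs).ne'
      simp only [c, Function.comp]
      field_simp
    · have h1 : ContinuousOn (fun s => logCut n (s * φ s)) (Ioi 0) :=
        ContinuousOn.comp (g := logCut n)
          (fun s hs => (hasDerivAt_logCut n hs).continuousAt.continuousWithinAt) hmulc hsφ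
      have h2 : ContinuousOn (fun s => logCutDeriv n (s * φ s)) (Ioi 0) :=
        (continuousOn_logCutDeriv n).comp hmulc hsφ
      exact ((h2.mul (continuousOn_const.add hφ.continuousOn_phiLog)).mul hφ.continuousOn).add
        (h1.mul (hφ.continuousOn.mul hφ.continuousOn_phiLog))
    · have h0 := logCut_eq_zero n (hsφ s hs) (by
        rw [← hfα, ← hfβ]
        intro h
        exact hmem ⟨(hφ.strictMonoOn_mul.le_iff_le hα hs).1 h.1,
          (hφ.strictMonoOn_mul.le_iff_le hs hβ).1 h.2⟩)
      simp [b, c, h0]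
  have hnorm : ∀ x, u x ≠ 0 → ‖phiMul φ u x‖ = ‖u x‖ * φ ‖u x‖ := fun x hx => by
    rw [phiMul, norm_smul, Real.norm_eq_abs, abs_of_pos (hφ.pos _ (norm_pos_iff.2 hx)), mul_comm]
  have hw' := fun n => hw.radial hΩ (radialProfile_logCut n)
  have hu' := fun n => hu.radial hΩ (hprof n)
  have heq : ∀ n, (fun x => logCut n ‖phiMul φ u x‖ • phiMul φ u x)
      = fun x => b n ‖u x‖ • u x := by
    intro n
    ext1 x
    rcases eq_or_ne (u x) 0 with hx | hx
    · simp [phiMul, hx]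
    · rw [hnorm x hx, phiMul, smul_smul]
  filter_upwards [ae_all_iff.2 fun n => ae_all_iff.2 fun k =>
    (hw' n).ae_unique hΩ (by rw [heq n]; exact hu' n) k] with x hx hx0 k
  -- At a fixed point a large enough `n` makes the cutoff equal to `1` with zero derivative.
  obtain ⟨n, h1, h2⟩ := (eventually_logCut (‖u x‖ * φ ‖u x‖)).exists
  have hs := norm_pos_iff.2 hx0
  have hw0 : phiMul φ u x ≠ 0 := by
    rw [← norm_pos_iff, hnorm x hx0]
    exact hsφ _ hs
  have := hx n k
  rw [radialDeriv_of_ne hw0, radialDeriv_of_ne hx0, hnorm x hx0] at this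
  simp only [b, c, h1, h2, one_smul, zero_smul, add_zero, one_mul, zero_mul, zero_add] at this
  rw [this, smul_add, smul_smul]

/-- If `u` and `φ(|u|) u` are in `H¹₀`, then so is `√φ(|u|) u`. -/
lemma exists_sqrtPhiMul_grad (hΩ : IsOpen Ω) (hφ : Admissible φ) (hu : HasH10Grad Ω u gu)
    (hw : HasH10Grad Ω (phiMul φ u) gw) :
    ∃ gv : Fin N → Pt N → CVec m, HasH10Grad Ω (sqrtPhiMul φ u) gv ∧
      (∀ x k, u x = 0 → gv k x = 0) ∧ ∀ x k, u x ≠ 0 →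
        gv k x = √(φ ‖u x‖) • (gu k x + (phiLog φ ‖u x‖ / 2) • radProj (u x) (gu k x)) := by
  classical
  obtain ⟨C, hC1, hC⟩ := hφ.exists_sqrt_bound
  obtain ⟨D, hD0, hD⟩ := exists_logCutDeriv_bound
  set b : ℕ → ℝ → ℝ := fun n s => logCut n s * √(φ s)
  set c : ℕ → ℝ → ℝ := fun n s => √(φ s) * (logCutDeriv n s + logCut n s * (phiLog φ s / 2))
  have hprof : ∀ n, RadialProfile (b n) (c n) := by
    intro n
    refine .of_eq_zero (Real.exp_pos (-(2 * (n + 1)))) (β := Real.exp (2 * (n + 1)))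
      (fun s hs => ?_) ?_ fun s hs hmem => ?_
    · refine ((hasDerivAt_logCut n hs).mul (hφ.hasDerivAt_sqrt hs)).congr_deriv ?_
      simp only [c]
      field_simp
    · refine hφ.continuousOn.sqrt.mul ((continuousOn_logCutDeriv n).add
        (ContinuousOn.mul (fun s hs => ?_) (hφ.continuousOn_phiLog.div_const 2)))
      exact (hasDerivAt_logCut n hs).continuousAt.continuousWithinAt
    · simp [b, c, logCut_eq_zero n hs hmem]
  have hsqrt : ∀ s, 0 < s → √(φ s) ≤ 1 + φ s := fun s hs => by
    nlinarith [Real.sq_sqrt (hφ.pos s hs).le, sq_nonneg (√(φ s) - 1), Real.sqrt_nonneg (φ s)]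
  set K : ℝ := 2 + (1 + D) * C
  refine ⟨fun k x => if u x = 0 then 0 else
    √(φ ‖u x‖) • (gu k x + (phiLog φ ‖u x‖ / 2) • radProj (u x) (gu k x)), ?_,
    fun x k hx => if_pos hx, fun x k hx => if_neg hx⟩
  refine HasH10Grad.of_dominated (B := fun x => ‖u x‖ + ‖phiMul φ u x‖)
    (B' := fun k x => K * (‖gu k x‖ + ‖gw k x‖)) (fun n => hu.radial hΩ (hprof n))
    (hu.memLp.norm.add hw.memLp.norm)
    (fun k => ((hu.memLp_grad k).norm.add (hw.memLp_grad k).norm).const_mul K)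
    (fun n => .of_forall fun x => ?_) (fun n k => ?_) (.of_forall fun x => ?_)
    (fun k => .of_forall fun x => ?_)
  · rcases eq_or_ne (u x) 0 with hx | hx
    · simp [hx]
    have hs := norm_pos_iff.2 hx
    have hp := hφ.pos _ hs
    obtain ⟨h0, h1⟩ := logCut_mem n ‖u x‖
    rw [phiMul, norm_smul, norm_smul, norm_mul, Real.norm_eq_abs, Real.norm_eq_abs,
      Real.norm_eq_abs, abs_of_nonneg h0, abs_of_nonneg (Real.sqrt_nonneg _), abs_of_pos hp]
    calc logCut n ‖u x‖ * √(φ ‖u x‖) * ‖u x‖ ≤ 1 * (1 + φ ‖u x‖) * ‖u x‖ := by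
          gcongr
          exact hsqrt _ hs
      _ = _ := by ring
  · filter_upwards [phiMul_grad hΩ hφ hu hw] with x hx
    have hK : 0 ≤ K := by positivity
    rcases eq_or_ne (u x) 0 with hx0 | hx0
    · simp only [radialDeriv, hx0, if_true, _root_.zero_apply, norm_zero]
      positivity
    have hs := norm_pos_iff.2 hx0
    have hp := hφ.pos _ hs
    have hy := hφ.neg_one_lt_phiLog hs
    obtain ⟨hl0, hl1⟩ := logCut_mem n ‖u x‖
    have hgw := hx hx0 k
    have hDn := hD n ‖u x‖
    have hCs := hC _ hs
    have hsq := hsqrt _ hs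
    have hsq0 := Real.sqrt_nonneg (φ ‖u x‖)
    rw [radialDeriv_of_ne hx0]
    simp only [b, c]
    set s := ‖u x‖
    set h := gu k x
    set p := radProj (u x) h with hpdef
    have hPw : radProj (u x) (gw k x) = (φ s * (1 + phiLog φ s)) • p := by
      rw [hgw, map_smul, map_add, map_smul, radProj_radProj, ← hpdef]
      module
    have hTw : gw k x - radProj (u x) (gw k x) = φ s • (h - p) := by
      rw [hPw, hgw]
      module
    have hp1 : ‖p‖ ≤ ‖h‖ := norm_radProj_apply_le _ _
    have hp2 : φ s * (1 + phiLog φ s) * ‖p‖ ≤ ‖gw k x‖ := by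
      have := norm_radProj_apply_le (u x) (gw k x)
      rwa [hPw, norm_smul, Real.norm_eq_abs,
        abs_of_pos (mul_pos hp (by linarith : 0 < 1 + phiLog φ s))] at this
    have ht1 : ‖h - p‖ ≤ 2 * ‖h‖ := (norm_sub_le _ _).trans (by linarith)
    have ht2 : φ s * ‖h - p‖ ≤ 2 * ‖gw k x‖ := by
      have h1 : ‖gw k x - radProj (u x) (gw k x)‖ ≤ 2 * ‖gw k x‖ :=
        (norm_sub_le _ _).trans (by linarith [norm_radProj_apply_le (u x) (gw k x)])
      rwa [hTw, norm_smul, Real.norm_eq_abs, abs_of_pos hp] at h1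
    -- Separate the part `h - p` orthogonal to `u`, handled by `√φ ≤ 1 + φ`, from the radial part
    -- `p`, handled by `exists_sqrt_bound`.
    have hsplit : (logCut n s * √(φ s)) • h
        + (√(φ s) * (logCutDeriv n s + logCut n s * (phiLog φ s / 2))) • p
        = (logCut n s * √(φ s)) • (h - p)
        + (√(φ s) * (logCut n s + (logCutDeriv n s + logCut n s * (phiLog φ s / 2)))) • p := by
      module
    rw [hsplit]
    refine (norm_add_le _ _).trans ?_
    rw [norm_smul, norm_smul, Real.norm_eq_abs, Real.norm_eq_abs, abs_mul, abs_mul,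
      abs_of_nonneg hl0, abs_of_nonneg hsq0]
    have hcoef : |logCut n s + (logCutDeriv n s + logCut n s * (phiLog φ s / 2))|
        ≤ (1 + D) * (1 + |phiLog φ s|) := by
      have e1 : |logCut n s * (phiLog φ s / 2)| ≤ |phiLog φ s| := by
        rw [abs_mul, abs_div, abs_of_nonneg hl0, abs_two]
        nlinarith [abs_nonneg (phiLog φ s)]
      have e2 := abs_add_le (logCut n s) (logCutDeriv n s + logCut n s * (phiLog φ s / 2))
      have e3 := abs_add_le (logCutDeriv n s) (logCut n s * (phiLog φ s / 2))
      rw [abs_of_nonneg hl0] at e2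
      nlinarith [abs_nonneg (phiLog φ s)]
    calc logCut n s * √(φ s) * ‖h - p‖
        + √(φ s) * |logCut n s + (logCutDeriv n s + logCut n s * (phiLog φ s / 2))| * ‖p‖
        ≤ 1 * (1 + φ s) * ‖h - p‖ + √(φ s) * ((1 + D) * (1 + |phiLog φ s|)) * ‖p‖ := by gcongr
      _ = (‖h - p‖ + φ s * ‖h - p‖) + (1 + D) * (√(φ s) * (1 + |phiLog φ s|)) * ‖p‖ := by ring
      _ ≤ (2 * ‖h‖ + 2 * ‖gw k x‖)
          + (1 + D) * (C * (1 + φ s * (1 + phiLog φ s))) * ‖p‖ := by gcongr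
      _ = (2 * ‖h‖ + 2 * ‖gw k x‖)
          + (1 + D) * C * (‖p‖ + φ s * (1 + phiLog φ s) * ‖p‖) := by ring
      _ ≤ (2 * ‖h‖ + 2 * ‖gw k x‖) + (1 + D) * C * (‖h‖ + ‖gw k x‖) := by gcongr
      _ = K * (‖h‖ + ‖gw k x‖) := by ring
  · refine tendsto_const_nhds.congr' ?_
    filter_upwards [eventually_logCut ‖u x‖] with n hn
    simp [b, hn, sqrtPhiMul]
  · by_cases hx : u x = 0
    · simp [hx, radialDeriv]
    · simp only [if_neg hx]
      refine tendsto_const_nhds.congr' ?_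
      filter_upwards [eventually_logCut ‖u x‖] with n hn
      rw [radialDeriv_of_ne hx]
      simp only [b, c, hn, one_mul, zero_add, smul_add, smul_smul]

end NonlinearGradient

/-! ### Transfer between the form and the functional. -/

lemma sesqForm_eq (hΩ : IsOpen Ω) {A : Coeff N m} {u w : Pt N → CVec m}
    {gu gw a b : Fin N → Pt N → CVec m} (hu : HasH10Grad Ω u gu) (hw : HasH10Grad Ω w gw)
    (h : ∀ᵐ x ∂(volume.restrict Ω), ∃ θ : ℝ, θ ≠ 0 ∧ ∀ k,
      gu k x = θ • a k x ∧ gw k x = θ⁻¹ • b k x) :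
    sesqForm Ω A u w = (∫ x in Ω, coeffForm A a b x).re := by
  rw [sesqForm]
  congr 1
  refine integral_congr_ae ?_
  filter_upwards [ae_all_iff.2 fun k => hu.weakPartial_ae_eq hΩ k,
    ae_all_iff.2 fun k => hw.weakPartial_ae_eq hΩ k, h] with x hx hx' ⟨θ, hθ, hab⟩
  simp only [coeffForm, hx, hx', hab, herm_act_smul, mul_inv_cancel₀ hθ, Complex.ofReal_one,
    one_mul]

/-- The form of `A` at `(u, φ(|u|) u)` is the functional at `√φ(|u|) u`. -/
lemma sesqForm_phiMul_eq_functional (hΩ : IsOpen Ω) (hφ : Admissible φ) {A : Coeff N m}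
    (hA : BoundedCoeff Ω A) {u : Pt N → CVec m} (hu : MemH10 Ω u) (hw : MemH10 Ω (phiMul φ u)) :
    MemH10 Ω (sqrtPhiMul φ u) ∧
      sesqForm Ω A u (phiMul φ u) = functional Ω φ A (sqrtPhiMul φ u) := by
  have hu' := hu.hasH10Grad hΩ
  have hw' := hw.hasH10Grad hΩ
  obtain ⟨gv, hgv, hgv0, hgv1⟩ := exists_sqrtPhiMul_grad hΩ hφ hu' hw'
  refine ⟨hgv.memH10 hΩ, ?_⟩
  rw [functional_eq hΩ hφ hA hgv]
  refine sesqForm_eq hΩ hu' hw' ?_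
  filter_upwards [hu'.ae_eq_zero hΩ, hw'.ae_eq_zero hΩ, phiMul_grad hΩ hφ hu' hw'] with x h1 h2 h3
  by_cases hx : u x = 0
  · refine ⟨1, one_ne_zero, fun k => ?_⟩
    have e1 : phiMul φ u x = 0 := by simp [phiMul, hx]
    have e2 : sqrtPhiMul φ u x = 0 := by simp [sqrtPhiMul, hx]
    simp [h1 hx k, h2 e1 k, hgv0 x k hx, e2]
  · have hs := norm_pos_iff.2 hx
    have hp := Real.sqrt_pos.2 (hφ.pos _ hs)
    have hy := hφ.neg_one_lt_phiLog hs
    -- This factor is `Θ(|v|)`. Since `Λ(|v|) = -y / (y + 2)`, the correction is `-√φ (y/2)` times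
    -- the projection of `∂_k u`: adding it leaves `√φ ∂_k u`, subtracting it gives `φ^(-1/2) ∂_k
    -- (φ(|u|) u)`.
    refine ⟨(√(φ ‖u x‖))⁻¹, inv_ne_zero hp.ne', fun k => ?_⟩
    have hnorm : ‖sqrtPhiMul φ u x‖ = ‖u x‖ * √(φ ‖u x‖) := by
      rw [sqrtPhiMul, norm_smul, Real.norm_eq_abs, abs_of_pos hp, mul_comm]
    have hlam : lamProj φ (sqrtPhiMul φ u x) (gv k x)
        = (√(φ ‖u x‖) * -(phiLog φ ‖u x‖ / 2)) • radProj (u x) (weakPartial Ω k u x) := by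
      rw [lamProj, hnorm, hφ.Lam_eq (hφ.mul_sqrt_pos hs), hφ.zeta_apply hs, sqrtPhiMul,
        radProj_smul hp.ne', hgv1 x k hx, map_smul, map_add, map_smul, radProj_radProj]
      have : phiLog φ ‖u x‖ + 2 ≠ 0 := by linarith
      match_scalars
      field_simp
      ring
    have hsq : φ ‖u x‖ = √(φ ‖u x‖) * √(φ ‖u x‖) :=
      (Real.mul_self_sqrt (hφ.pos _ hs).le).symm
    rw [hlam, h3 hx k, hgv1 x k hx, inv_inv]
    constructor
    · match_scalars
      · field_simp
      · ring
    · nth_rewrite 1 [hsq]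
      match_scalars
      · ring
      · ring

/-- Every element of `H¹₀` is the limit of functions `√φ(|u|) u` with `u` and `φ(|u|) u` in
`H¹₀`, in a way that the quadratic quantities converge. -/
lemma le_functional_of_forall (hΩ : IsOpen Ω) (hφ : Admissible φ) {A : Coeff N m}
    (hA : BoundedCoeff Ω A) {κ : ℝ}
    (h : ∀ u : Pt N → CVec m, MemH10 Ω u → MemH10 Ω (phiMul φ u) →
      κ * ∫ x in Ω, gradSq Ω (sqrtPhiMul φ u) x ≤ sesqForm Ω A u (phiMul φ u))
    {v : Pt N → CVec m} (hv : MemH10 Ω v) :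
    κ * ∫ x in Ω, gradSq Ω v x ≤ functional Ω φ A v := by
  have hv' := hv.hasH10Grad hΩ
  set g : Fin N → Pt N → CVec m := fun k => weakPartial Ω k v
  obtain ⟨t₀, C, α, ht₀, hα, hzb⟩ := hφ.exists_zeta_bound
  -- Any order with `(q + 1) α ≥ 2` works; taking a successor also ensures `q ≠ 0`.
  obtain ⟨q₀, hq₀⟩ := exists_nat_ge (2 / α)
  set q := q₀ + 1
  have hq : 2 ≤ ((q : ℝ) + 1) * α := by
    rw [div_le_iff₀ hα] at hq₀
    push_cast [q]
    nlinarith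
  set e : ℕ → ℝ := fun n => 1 / ((n : ℝ) + 1)
  have he : Tendsto e atTop (𝓝 0) := tendsto_one_div_add_atTop_nhds_zero_nat
  have hepos : ∀ n, 0 < e n := fun n => by positivity
  set X : ℕ → Fin N → Pt N → CVec m := fun n k x =>
    radialDeriv (damp q (e n)) (fun t => damp q (e n) t * dampLog q (e n) t) (v x) (g k x)
  set vn : ℕ → Pt N → CVec m := fun n x => damp q (e n) ‖v x‖ • v x
  have hvn : ∀ n, HasH10Grad Ω (vn n) (X n) := fun n =>
    hv'.radial hΩ (radialProfile_damp (Nat.succ_ne_zero q₀) (hepos n))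
  have hun := fun n => hv'.radial hΩ (hφ.logProfile.radialProfile_damp ht₀ hα
    (fun t ht htt => (hzb t ht htt).1) hq (hepos n))
  have hwn := fun n => hv'.radial hΩ (hφ.logProfile.inv.radialProfile_damp ht₀ hα
    (fun t ht htt => (hzb t ht htt).2) hq (hepos n))
  set un : ℕ → Pt N → CVec m := fun n x =>
    (Theta φ (‖v x‖ * damp q (e n) ‖v x‖) * damp q (e n) ‖v x‖) • v x
  have hψ : ∀ n x, v x ≠ 0 → 0 < ‖v x‖ * damp q (e n) ‖v x‖ := fun n x hx =>
    mul_pos (norm_pos_iff.2 hx) (damp_pos (hepos n) (norm_pos_iff.2 hx))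
  have hunorm : ∀ n x, v x ≠ 0 → ‖un n x‖ = zeta φ (‖v x‖ * damp q (e n) ‖v x‖) := by
    intro n x hx
    have hp := hψ n x hx
    have hd := damp_pos (q := q) (hepos n) (norm_pos_iff.2 hx)
    rw [norm_smul, Real.norm_eq_abs, abs_of_pos (mul_pos (hφ.Theta_pos hp) hd), mul_assoc,
      mul_comm (damp _ _ _), Theta, div_mul_cancel₀ _ hp.ne']
  have hphi : ∀ n, phiMul φ (un n) = fun x =>
      ((Theta φ (‖v x‖ * damp q (e n) ‖v x‖))⁻¹ * damp q (e n) ‖v x‖) • v x := by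
    intro n
    ext1 x
    rcases eq_or_ne (v x) 0 with hx | hx
    · simp [phiMul, un, hx]
    have hT := (hφ.Theta_pos (hψ n x hx)).ne'
    rw [phiMul, hunorm n x hx, hφ.phi_zeta (hψ n x hx), smul_smul]
    congr 1
    field_simp
  -- The test function `un n` is the preimage of the damped `vn n` under the substitution.
  have hsqrt : ∀ n, sqrtPhiMul φ (un n) = vn n := by
    intro n
    ext1 x
    rcases eq_or_ne (v x) 0 with hx | hx
    · simp [sqrtPhiMul, un, vn, hx]
    have hT := (hφ.Theta_pos (hψ n x hx)).ne'
    rw [sqrtPhiMul, hunorm n x hx, hφ.sqrt_phi_zeta (hψ n x hx), smul_smul,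
      inv_mul_cancel_left₀ hT]
  set a : ℕ → Fin N → Pt N → CVec m := fun n k x => X n k x + lamProj φ (vn n x) (X n k x)
  set b : ℕ → Fin N → Pt N → CVec m := fun n k x => X n k x - lamProj φ (vn n x) (X n k x)
  have hkey : ∀ n, κ * ∫ x in Ω, ∑ k, ‖X n k x‖ ^ 2 ≤ (∫ x in Ω, coeffForm A (a n) (b n) x).re := by
    intro n
    have hwn' := hwn n
    rw [← hphi n] at hwn'
    have h1 := h (un n) ((hun n).memH10 hΩ) (hwn'.memH10 hΩ)
    rw [hsqrt n] at h1
    have h2 : ∫ x in Ω, gradSq Ω (vn n) x = ∫ x in Ω, ∑ k, ‖X n k x‖ ^ 2 := by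
      refine integral_congr_ae ?_
      filter_upwards [ae_all_iff.2 fun k => (hvn n).weakPartial_ae_eq hΩ k] with x hx
      simp only [gradSq, hx]
    rw [h2] at h1
    refine h1.trans (le_of_eq (sesqForm_eq hΩ (hun n) hwn' (.of_forall fun x => ?_)))
    by_cases hx : v x = 0
    · exact ⟨1, one_ne_zero, fun k => by simp [a, b, X, vn, hx, radialDeriv]⟩
    have hT := (hφ.Theta_pos (hψ n x hx)).ne'
    have hd := damp_pos (q := q) (hepos n) (norm_pos_iff.2 hx)
    refine ⟨_, hT, fun k => ?_⟩
    have hnv : ‖vn n x‖ = ‖v x‖ * damp q (e n) ‖v x‖ := by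
      rw [norm_smul, Real.norm_eq_abs, abs_of_pos hd, mul_comm]
    simp only [a, b, lamProj, hnv]
    rw [show radProj (vn n x) = radProj (v x) from radProj_smul hd.ne' _]
    simp only [X]
    rw [radialDeriv_of_ne hx, radialDeriv_of_ne hx, radialDeriv_of_ne hx, map_add, map_smul,
      map_smul, radProj_radProj]
    constructor
    · match_scalars <;> ring
    · match_scalars <;> ring
  -- With `q` fixed this majorant is independent of `n` and serves both limits below.
  have hXb : ∀ n k x, ‖X n k x‖ ≤ (q + 2) * ‖g k x‖ := fun n k x =>
    norm_radialDeriv_damp_le (hepos n) _ _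
  have hXlim : ∀ᵐ x ∂(volume.restrict Ω), ∀ k, Tendsto (fun n => X n k x) atTop (𝓝 (g k x)) := by
    filter_upwards [hv'.ae_eq_zero hΩ] with x hx k
    by_cases hx0 : v x = 0
    · simp [X, radialDeriv, hx0, hx hx0 k]
    · exact tendsto_radialDeriv_damp he hx0 _
  have hLlim : ∀ᵐ x ∂(volume.restrict Ω), ∀ k, Tendsto (fun n => lamProj φ (vn n x) (X n k x))
      atTop (𝓝 (lamProj φ (v x) (g k x))) := by
    filter_upwards [hXlim] with x hx k
    by_cases hx0 : v x = 0
    · simp [vn, hx0]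
    · refine tendsto_lamProj hφ hx0 ?_ (hx k)
      simpa using (tendsto_damp (q := q) he (norm_pos_iff.2 hx0)).smul_const (v x)
  have hXm : ∀ n k, AEStronglyMeasurable (X n k) (volume.restrict Ω) := fun n k =>
    ((hvn n).memLp_grad k).aestronglyMeasurable
  have hLm : ∀ n k, AEStronglyMeasurable (fun x => lamProj φ (vn n x) (X n k x))
      (volume.restrict Ω) := fun n k =>
    aestronglyMeasurable_lamProj hφ (hvn n).memLp.aestronglyMeasurable (hXm n k)
  have hlim1 : Tendsto (fun n => (∫ x in Ω, coeffForm A (a n) (b n) x).re) atTop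
      (𝓝 (functional Ω φ A v)) := by
    rw [functional_eq hΩ hφ hA hv']
    refine (Complex.continuous_re.tendsto _).comp (tendsto_integral_coeffForm hA
      (B := fun k x => 2 * ((q + 2) * ‖g k x‖))
      (fun k => ((hv'.memLp_grad k).norm.const_mul _).const_mul _)
      (fun n k => (hXm n k).add (hLm n k)) (fun n k => (hXm n k).sub (hLm n k))
      (fun n k x => ?_) (fun n k x => ?_) ?_ ?_)
    · exact (norm_add_le _ _).trans
        (by linarith [hXb n k x, norm_lamProj_le hφ (vn n x) (X n k x)])
    · exact (norm_sub_le _ _).trans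
        (by linarith [hXb n k x, norm_lamProj_le hφ (vn n x) (X n k x)])
    · filter_upwards [hXlim, hLlim] with x h1 h2 k
      exact (h1 k).add (h2 k)
    · filter_upwards [hXlim, hLlim] with x h1 h2 k
      exact (h1 k).sub (h2 k)
  have hlim2 : Tendsto (fun n => ∫ x in Ω, ∑ k, ‖X n k x‖ ^ 2) atTop
      (𝓝 (∫ x in Ω, gradSq Ω v x)) := by
    refine tendsto_integral_of_dominated_convergence (fun x => ∑ k, ((q + 2) * ‖g k x‖) ^ 2)
      (fun n => Finset.aestronglyMeasurable_fun_sum _ fun k _ => (hXm n k).norm.pow 2)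
      (integrable_finsetSum _ fun k _ => ((hv'.memLp_grad k).norm.const_mul _).integrable_sq)
      (fun n => .of_forall fun x => ?_) ?_
    · rw [Real.norm_of_nonneg (by positivity)]
      refine Finset.sum_le_sum fun k _ => ?_
      gcongr
      exact hXb n k x
    · filter_upwards [hXlim] with x hx
      exact tendsto_finsetSum _ fun k _ => (hx k).norm.pow 2
  exact le_of_tendsto_of_tendsto' (hlim2.const_mul κ) hlim1 hkey

lemma forall_le_sesqForm_iff (hΩ : IsOpen Ω) (hφ : Admissible φ) {A : Coeff N m}
    (hA : BoundedCoeff Ω A) (κ : ℝ) :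
    (∀ u : Pt N → CVec m, MemH10 Ω u → MemH10 Ω (phiMul φ u) →
      κ * ∫ x in Ω, gradSq Ω (sqrtPhiMul φ u) x ≤ sesqForm Ω A u (phiMul φ u)) ↔
    ∀ v : Pt N → CVec m, MemH10 Ω v → κ * ∫ x in Ω, gradSq Ω v x ≤ functional Ω φ A v := by
  refine ⟨fun h v hv => le_functional_of_forall hΩ hφ hA h hv, fun h u hu hw => ?_⟩
  obtain ⟨h1, h2⟩ := sesqForm_phiMul_eq_functional hΩ hφ hA hu hw
  rw [h2]
  exact h _ h1

end FunctionalDissipativity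

theorem lemma3p3 {N m : ℕ} (Ω : Set (FunctionalDissipativity.Pt N)) (hΩ : IsOpen Ω)
    (φ : ℝ → ℝ) (hφ : FunctionalDissipativity.Admissible φ)
    (A : FunctionalDissipativity.Coeff N m)
    (hA : FunctionalDissipativity.BoundedCoeff Ω A) :
    (FunctionalDissipativity.IsDissipative Ω φ A ↔
      ∀ v : FunctionalDissipativity.Pt N → FunctionalDissipativity.CVec m,
        FunctionalDissipativity.MemH10 Ω v →
          0 ≤ FunctionalDissipativity.functional Ω φ A v) ∧
    (FunctionalDissipativity.IsStrictDissipative Ω φ A ↔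
      ∃ κ : ℝ, 0 < κ ∧
        ∀ v : FunctionalDissipativity.Pt N → FunctionalDissipativity.CVec m,
          FunctionalDissipativity.MemH10 Ω v →
            κ * ∫ x in Ω, FunctionalDissipativity.gradSq Ω v x
              ≤ FunctionalDissipativity.functional Ω φ A v) := by
  constructor
  · have h := FunctionalDissipativity.forall_le_sesqForm_iff hΩ hφ hA 0
    simp only [zero_mul] at h
    exact h
  · exact exists_congr fun κ => and_congr_right fun _ =>
      FunctionalDissipativity.forall_le_sesqForm_iff hΩ hφ hA κ
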